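/- An interval exchange transformation with flips on $n\ge 2$ intervals ($n$-fIET) is given by a vector $\lambda=(\lambda_\alpha)_{\alpha\in\mathcal A}$ of positive lengths with $\sum_\alpha\lambda_\alpha=1$, $|\mathcal A|=n$, and a pair $\hat\pi=(\pi_0,\pi_1)$, where $\pi_0:\mathcal A\to\{1,\dots,n\}$ is a bijection and $\pi_1:\mathcal A\to\{-n,\dots,-1,1,\dots,n\}$ is such that $|\pi_1|$ is a bijection onto $\{1,\dots,n\}$ and the flip set $F=\{\alpha:\pi_1(\alpha)<0\}$ is non-empty. The interval $[0,1)$ is cut into consecutive intervals $I_\alpha$ of length $\lambda_\alpha$ in the order given by $\pi_0$; the map $f$ is defined on $\bigcup_\alpha \mathrm{int}(I_\alpha)$ and sends $\mathrm{int}(I_\alpha)$ isometrically, preserving the orientation if $\alpha\notin F$ and reversing it if $\alpha\in F$, onto the interior of the interval at the position $|\pi_1|(\alpha)$ in the arrangement of consecutive intervals of lengths $\lambda_\alpha$ in the order given by $|\pi_1|$. The orbit of $x$ is the set of all $f^k(x)$, $k\in\mathbb Z$, that are defined. The fIET is minimal if every orbit is dense in $[0,1)$ except for the orbits that stop both in the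 future and in the past, and it is uniquely ergodic if there is exactly one Borel probability measure $\mu$ on $[0,1)$ with $\mu(f^{-1}(A))=\mu(A)$ for all Borel sets $A$. Theorem. For every $n\ge 2$, the set $NUE_n$ of parameters $(\lambda,\hat\pi)$ of minimal $n$-fIETs that are not uniquely ergodic satisfies $$\left[\frac{n-1}{2}\right]-1\le \dim_H(NUE_n),$$ where $[\cdot]$ is the integer part, and the Hausdorff dimension (with $\dim_H\emptyset=0$) is that of a subset of the product of the simplex of length vectors in $\mathbb R^{\mathcal A}$ and of the finite discrete set of all $\hat\pi$. -/

import Mathlib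

open scoped ENNReal

namespace FlipIET

/-- The space of parameters `(ℓ, π₀, π₁)` of interval exchanges on `n` intervals labelled by `Fin n`:
a length vector and two integer valued maps, the continuous and the discrete parameters.
It carries the product metric; since `ℤ` is uniformly discrete, the Hausdorff dimension of a set of
parameters is the maximum, over the finitely many combinatorial data, of the dimension of the
corresponding sets of length vectors. -/
abbrev Param (n : ℕ) : Type := (Fin n → ℝ) × (Fin n → ℤ) × (Fin n → ℤ)

variable {n : ℕ}

/-- `π₀` is a bijection of the alphabet onto `{1, …, n}`, and `π₁` takes values in
`{-n, …, -1, 1, …, n}` and `|π₁|` is a bijection onto `{1, …, n}`. -/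
def IsGenPerm (π₀ π₁ : Fin n → ℤ) : Prop :=
  Set.BijOn π₀ Set.univ (Set.Icc 1 (n : ℤ)) ∧
    Set.BijOn (fun α => |π₁ α|) Set.univ (Set.Icc 1 (n : ℤ))

/-- The letters whose intervals are flipped. -/
def flipSet (π₁ : Fin n → ℤ) : Set (Fin n) := {α | π₁ α < 0}

/-- The parameter describes an interval exchange transformation with flips (at least one flip)
of the unit interval `[0,1)`. -/
def IsFIET (p : Param n) : Prop :=
  (∀ α, 0 < p.1 α) ∧ ∑ α, p.1 α = 1 ∧ IsGenPerm p.2.1 p.2.2 ∧ (flipSet p.2.2).Nonempty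

/-- The left endpoint of the interval `I_α`. -/
noncomputable def leftEnd (p : Param n) (α : Fin n) : ℝ :=
  ∑ β with p.2.1 β < p.2.1 α, p.1 β

/-- The interior of the interval `I_α`. -/
def openPiece (p : Param n) (α : Fin n) : Set ℝ :=
  Set.Ioo (leftEnd p α) (leftEnd p α + p.1 α)

/-- The left endpoint of the image of `I_α`. -/
noncomputable def imageLeftEnd (p : Param n) (α : Fin n) : ℝ :=
  ∑ β with |p.2.2 β| < |p.2.2 α|, p.1 β

/-- The right endpoint of the image of `I_α`. -/
noncomputable def imageRightEnd (p : Param n) (α : Fin n) : ℝ :=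
  ∑ β with |p.2.2 β| ≤ |p.2.2 α|, p.1 β

/-- The graph of the transformation `f`, which is defined on the union of the interiors of the
intervals `I_α` only: `Step p x y` says that `f x` is defined and equal to `y`.
On an unflipped interval, `f` is the translation onto the image interval; on a flipped one, it is
the orientation reversing isometry onto the image interval. -/
def Step (p : Param n) (x y : ℝ) : Prop :=
  ∃ α, x ∈ openPiece p α ∧
    ((α ∉ flipSet p.2.2 ∧ y = x + (imageLeftEnd p α - leftEnd p α)) ∨
      (α ∈ flipSet p.2.2 ∧ y = (imageRightEnd p α + leftEnd p α) - x))

/-- The orbit `{f^k(x) : k ∈ ℤ, f^k(x) is defined}`. -/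
def orbit (p : Param n) (x : ℝ) : Set ℝ :=
  {y | Relation.ReflTransGen (Step p) x y ∨ Relation.ReflTransGen (Step p) y x}

/-- All forward iterates of `x` are defined. -/
def ForwardInfinite (p : Param n) (x : ℝ) : Prop :=
  ∃ u : ℕ → ℝ, u 0 = x ∧ ∀ k, Step p (u k) (u (k + 1))

/-- All backward iterates of `x` are defined. -/
def BackwardInfinite (p : Param n) (x : ℝ) : Prop :=
  ∃ u : ℕ → ℝ, u 0 = x ∧ ∀ k, Step p (u (k + 1)) (u k)

/-- Minimality: every orbit is dense in `[0,1)`, apart from the orbits that stop both in the future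
and in the past. (The orbit of the point `0` always is such an orbit, it is reduced to `{0}`.)
A periodic orbit never stops, so that a minimal transformation has none. -/
def IsMinimal (p : Param n) : Prop :=
  ∀ x ∈ Set.Ico (0 : ℝ) 1, ForwardInfinite p x ∨ BackwardInfinite p x →
    Set.Ico (0 : ℝ) 1 ⊆ closure (orbit p x)

/-- `μ` is an invariant Borel probability measure on `[0,1)`: `μ (f⁻¹ A) = μ A` for all Borel `A`. -/
def IsInvariantProb (p : Param n) (μ : MeasureTheory.Measure ℝ) : Prop :=
  MeasureTheory.IsProbabilityMeasure μ ∧ μ (Set.Ico (0 : ℝ) 1)ᶜ = 0 ∧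
    ∀ A : Set ℝ, MeasurableSet A → μ {x | ∃ y ∈ A, Step p x y} = μ A

/-- There is exactly one invariant Borel probability measure. -/
def IsUniquelyErgodic (p : Param n) : Prop :=
  ∃! μ : MeasureTheory.Measure ℝ, IsInvariantProb p μ

/-- The set of minimal, non-uniquely ergodic interval exchange transformations with flips on `n`
intervals. -/
def NUE (n : ℕ) : Set (Param n) :=
  {p | IsFIET p ∧ IsMinimal p ∧ ¬ IsUniquelyErgodic p}

end FlipIET

/-! Write n = 2j + 3 + e with e ∈ {0, 1} and j = [(n-1)/2] - 1; only j > 0 needs an argument.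

Flips are created by conjugation. Let T be an exchange without flips that reverses the order of four
intervals of lengths x₀, …, x₃ with x₀ < x₃, and let g reverse each of j adjacent intervals of
lengths c₀, …, c_{j-1} at the left end of the first one. Then g T g is an exchange with flips on n
intervals: exactly the j reversed intervals and their T-preimages, which lie in the last interval,
are flipped, and e records whether the j intervals leave a remainder of the first one. As g is an
involution that is continuous off a finite set, minimality and distinct atomless invariant measures
pass from T to g T g (`isMinimal_of_conj`, `isInvariantProb_of_conj`, `flipParam_mem_NUE`).

T comes from a Keane-type construction. Left Rauzy induction is prescribed as an infinite sequence
of rounds whose repetition numbers grow like 15^k; normalised lengths that follow it forever form a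
convex set (`Admissible`). Every orbit meets every piece in bounded time at every level, and the
levels shrink to length 0, whence minimality (`Admissible.fine`). If L and L' follow the same
sequence, the maps that match the pieces of the two level-N transformations, lifted to level 0,
converge to a semiconjugacy with finite fibres (`exists_semiconj`). It carries Lebesgue measure for
L' to an invariant measure of the transformation for L that gives the pieces the masses L' 0 i. Two
families of cones preserved by the rounds yield admissible lengths with x₁ ≥ 1/6 and with x₁ ≤ 1/7
(`exists_admissible_ge`, `exists_admissible_le`), so every x₁ = s strictly between occurs together
with two invariant measures (`exists_admissible_family`).

Finally, s and j - 1 of the lengths c_i vary independently. Projection to these j coordinates is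
1-Lipschitz and its image of the set in question contains a non-empty open subset of ℝ^j
(`le_dimH_NUE`). -/

namespace FlipIET

/-! ### Tilings of an interval and their behaviour under one induction step -/

/-- Half-open intervals with left endpoints `left i` and lengths `len i` that tile `[lo, hi)`. -/
structure IsTiling {ι : Type*} (lo hi : ℝ) (left len : ι → ℝ) : Prop where
  cover : ∀ x ∈ Set.Ico lo hi, ∃ i, x ∈ Set.Ico (left i) (left i + len i)
  sub : ∀ i, ∀ x ∈ Set.Ico (left i) (left i + len i), x ∈ Set.Ico lo hi
  disj : ∀ i j x, x ∈ Set.Ico (left i) (left i + len i) →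
    x ∈ Set.Ico (left j) (left j + len j) → i = j

namespace IsTiling

variable {ι : Type*} {lo hi : ℝ} {left len left' len' : ι → ℝ} {w l : ι}

/-- This is what induction does on the side of the winner: the first interval loses its initial
segment of length `d`, which is also what the domain loses. -/
theorem trim (h : IsTiling lo hi left len) {d : ℝ} (hd : 0 ≤ d) (hw : left w = lo)
    (hdw : d < len w) (hleft : left' w = lo + d) (hlen : len' w = len w - d)
    (hne : ∀ i, i ≠ w → left' i = left i ∧ len' i = len i) :
    IsTiling (lo + d) hi left' len' := by
  have key : ∀ i x, x ∈ Set.Ico (left' i) (left' i + len' i) ↔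
      x ∈ Set.Ico (left i) (left i + len i) ∧ lo + d ≤ x := by
    intro i x
    by_cases hi : i = w
    · subst hi
      simp only [Set.mem_Ico, hleft, hlen, hw]
      constructor
      · rintro ⟨h1, h2⟩
        refine ⟨⟨?_, ?_⟩, ?_⟩ <;> linarith
      · rintro ⟨⟨h1, h2⟩, h3⟩
        refine ⟨?_, ?_⟩ <;> linarith
    · rw [(hne i hi).1, (hne i hi).2]
      refine ⟨fun hx => ⟨hx, ?_⟩, fun hx => hx.1⟩
      by_contra! hlt
      refine hi (h.disj i w x hx ?_)
      have := (h.sub i x hx).1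
      rw [hw]
      exact ⟨this, by linarith⟩
  refine ⟨fun x hx => ?_, fun i x hx => ?_, fun i j x hi hj => ?_⟩
  · obtain ⟨i, hi⟩ := h.cover x ⟨by linarith [hx.1], hx.2⟩
    exact ⟨i, (key i x).2 ⟨hi, hx.1⟩⟩
  · have := (key i x).1 hx
    exact ⟨this.2, (h.sub i x this.1).2⟩
  · exact h.disj i j x ((key i x).1 hi).1 ((key j x).1 hj).1

/-- This is the side of the loser: the first interval `l` is cut off the domain and its label
reappears on an initial segment of `w`. -/
theorem replace (h : IsTiling lo hi left len) (hwl : w ≠ l) (hl : left l = lo)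
    (hpos : 0 < len l) (hlt : len l < len w) (hleft_l : left' l = left w)
    (hleft_w : left' w = left w + len l) (hlen_l : len' l = len l)
    (hlen_w : len' w = len w - len l)
    (hne : ∀ i, i ≠ w → i ≠ l → left' i = left i ∧ len' i = len i) :
    IsTiling (lo + len l) hi left' len' := by
  have notl : ∀ i x, x ∈ Set.Ico (left i) (left i + len i) → i ≠ l → lo + len l ≤ x := by
    intro i x hx hi
    by_contra! hlt
    refine hi (h.disj i l x hx ?_)
    rw [hl]
    exact ⟨(h.sub i x hx).1, hlt⟩
  classical
  -- Every new interval lies in an old one, the relabelling being `l ↦ w` and the identity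
  -- elsewhere; disjointness then only has to be checked between `l` and `w`.
  have key : ∀ i x, x ∈ Set.Ico (left' i) (left' i + len' i) →
      x ∈ Set.Ico (left (if i = l then w else i))
        (left (if i = l then w else i) + len (if i = l then w else i)) := by
    intro i x hx
    by_cases hi : i = l
    · subst hi
      rw [hleft_l, hlen_l] at hx
      simp only [if_true]
      exact ⟨hx.1, by linarith [hx.2]⟩
    · simp only [hi, if_false]
      by_cases hiw : i = w
      · subst hiw
        rw [hleft_w, hlen_w] at hx
        exact ⟨by linarith [hx.1], by linarith [hx.2]⟩
      · rwa [(hne i hiw hi).1, (hne i hiw hi).2] at hx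
  have nel : ∀ i, (if i = l then w else i) ≠ l := by
    intro i
    split_ifs with hi
    · exact hwl
    · exact hi
  refine ⟨fun x hx => ?_, fun i x hx => ?_, fun i j x hi hj => ?_⟩
  · obtain ⟨i, hi⟩ := h.cover x ⟨by linarith [hx.1], hx.2⟩
    have hil : i ≠ l := by
      rintro rfl
      rw [hl] at hi
      linarith [hx.1, hi.2]
    by_cases hiw : i = w
    · subst hiw
      by_cases hx2 : x < left i + len l
      · exact ⟨l, by rw [hleft_l, hlen_l]; exact ⟨hi.1, hx2⟩⟩
      · refine ⟨i, ?_⟩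
        rw [hleft_w, hlen_w]
        exact ⟨not_lt.1 hx2, by linarith [hi.2]⟩
    · exact ⟨i, by rwa [(hne i hiw hil).1, (hne i hiw hil).2]⟩
  · exact ⟨notl _ x (key i x hx) (nel i), (h.sub _ x (key i x hx)).2⟩
  · have h1 := h.disj _ _ x (key i x hi) (key j x hj)
    by_cases hil : i = l <;> by_cases hjl : j = l
    · rw [hil, hjl]
    · rw [if_pos hil, if_neg hjl] at h1
      subst hil h1
      rw [hleft_l, hlen_l] at hi
      rw [hleft_w] at hj
      linarith [hi.2, hj.1]
    · rw [if_neg hil, if_pos hjl] at h1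
      subst hjl h1
      rw [hleft_l, hlen_l] at hj
      rw [hleft_w] at hi
      linarith [hj.2, hi.1]
    · rwa [if_neg hil, if_neg hjl] at h1

end IsTiling

/-! ### Exchanges without flips, induction and recurrence -/

/-- The data of an interval exchange transformation (without flips) of `[lo, hi)`: the interval
with left endpoint `top i` and length `len i` is translated to the one with left endpoint `bot i`. -/
structure Exchange (ι : Type*) where
  lo : ℝ
  hi : ℝ
  top : ι → ℝ
  bot : ι → ℝ
  len : ι → ℝ

namespace Exchange

variable {ι : Type*} (D D₁ : Exchange ι)

def dom : Set ℝ := Set.Ico D.lo D.hi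

def piece (i : ι) : Set ℝ := Set.Ico (D.top i) (D.top i + D.len i)

def shift (i : ι) : ℝ := D.bot i - D.top i

structure Valid : Prop where
  len_pos : ∀ i, 0 < D.len i
  tiling_top : IsTiling D.lo D.hi D.top D.len
  tiling_bot : IsTiling D.lo D.hi D.bot D.len

open Classical in
/-- The transformation, extended by the identity outside of `[lo, hi)`. -/
noncomputable def map (x : ℝ) : ℝ :=
  if h : ∃ i, x ∈ D.piece i then x + D.shift h.choose else x

variable {D D₁}

theorem Valid.map_eq (h : D.Valid) {i : ι} {x : ℝ} (hx : x ∈ D.piece i) :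
    D.map x = x + D.shift i := by
  have hex : ∃ i, x ∈ D.piece i := ⟨i, hx⟩
  rw [map, dif_pos hex, h.tiling_top.disj _ _ x hex.choose_spec hx]

theorem Valid.exists_piece (h : D.Valid) {x : ℝ} (hx : x ∈ D.dom) : ∃ i, x ∈ D.piece i :=
  h.tiling_top.cover x hx

theorem Valid.piece_subset (h : D.Valid) {i : ι} {x : ℝ} (hx : x ∈ D.piece i) : x ∈ D.dom :=
  h.tiling_top.sub i x hx

theorem Valid.piece_unique (h : D.Valid) {i j : ι} {x : ℝ} (hi : x ∈ D.piece i)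
    (hj : x ∈ D.piece j) : i = j :=
  h.tiling_top.disj i j x hi hj

theorem Valid.top_mem (h : D.Valid) (i : ι) : D.top i ∈ D.piece i :=
  ⟨le_rfl, by linarith [h.len_pos i]⟩

theorem add_shift_mem {i : ι} {x : ℝ} (hx : x ∈ D.piece i) :
    x + D.shift i ∈ Set.Ico (D.bot i) (D.bot i + D.len i) := by
  unfold piece at hx
  unfold shift
  exact ⟨by linarith [hx.1], by linarith [hx.2]⟩

theorem Valid.add_shift_mem_dom (h : D.Valid) {i : ι} {x : ℝ} (hx : x ∈ D.piece i) :
    x + D.shift i ∈ D.dom :=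
  h.tiling_bot.sub i _ (add_shift_mem hx)

theorem Valid.map_mem (h : D.Valid) {x : ℝ} (hx : x ∈ D.dom) : D.map x ∈ D.dom := by
  obtain ⟨i, hi⟩ := h.exists_piece hx
  rw [h.map_eq hi]
  exact h.add_shift_mem_dom hi

theorem Valid.iterate_mem (h : D.Valid) {x : ℝ} (hx : x ∈ D.dom) (t : ℕ) :
    D.map^[t] x ∈ D.dom := by
  induction t with
  | zero => exact hx
  | succ t ih => rw [Function.iterate_succ_apply']; exact h.map_mem ih

/-- `D₁` is the transformation induced by `D` on `[D₁.lo, hi)`; the points of the piece `l` of `D₁`,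
and only these, return after two iterations, through the pieces `v` and `m` of `D`. -/
structure Induced (D D₁ : Exchange ι) (l v m : ι) : Prop where
  valid : D.Valid
  valid₁ : D₁.Valid
  hi_eq : D₁.hi = D.hi
  lo_le : D.lo ≤ D₁.lo
  piece_l : ∀ x ∈ D₁.piece l, x ∈ D.piece v ∧ x + D.shift v ∈ Set.Ico D.lo D₁.lo
  cut : ∀ x ∈ Set.Ico D.lo D₁.lo, x - D.shift v ∈ D₁.piece l ∧ x ∈ D.piece m
  shift_l : D₁.shift l = D.shift v + D.shift m
  piece_ne : ∀ i, i ≠ l → ∀ x ∈ D₁.piece i, x ∈ D.piece i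
  shift_ne : ∀ i, i ≠ l → D₁.shift i = D.shift i
  loser : v = l ∨ m = l

section Moves

variable {w l : ι}

/-- Left induction where the interval whose image comes first is the longest. -/
theorem Valid.induced_bot (h : D.Valid) (hwl : w ≠ l) (htl : D.top l = D.lo) (hbw : D.bot w = D.lo)
    (hlt : D.len l < D.len w) (hlo : D₁.lo = D.lo + D.len l) (hhi : D₁.hi = D.hi)
    (top_l : D₁.top l = D.top w) (top_w : D₁.top w = D.top w + D.len l)
    (bot_l : D₁.bot l = D.bot l) (bot_w : D₁.bot w = D.lo + D.len l)
    (len_l : D₁.len l = D.len l) (len_w : D₁.len w = D.len w - D.len l)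
    (hne : ∀ i, i ≠ w → i ≠ l → D₁.top i = D.top i ∧ D₁.bot i = D.bot i ∧ D₁.len i = D.len i) :
    Induced D D₁ l w l := by
  have hpos := h.len_pos
  have h₁ : D₁.Valid := by
    refine ⟨fun i => ?_, ?_, ?_⟩
    · by_cases hiw : i = w
      · subst hiw; rw [len_w]; linarith
      · by_cases hil : i = l
        · subst hil; rw [len_l]; exact hpos _
        · rw [(hne i hiw hil).2.2]; exact hpos _
    · rw [hlo, hhi]
      exact h.tiling_top.replace hwl htl (hpos l) hlt top_l top_w len_l len_w
        fun i h1 h2 => ⟨(hne i h1 h2).1, (hne i h1 h2).2.2⟩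
    · rw [hlo, hhi]
      refine h.tiling_bot.trim (hpos l).le hbw hlt bot_w len_w fun i hi => ?_
      by_cases hil : i = l
      · subst hil; exact ⟨bot_l, len_l⟩
      · exact ⟨(hne i hi hil).2.1, (hne i hi hil).2.2⟩
  refine ⟨h, h₁, hhi, by linarith [hpos l], fun x hx => ?_, fun x hx => ?_, ?_, ?_, ?_, Or.inr rfl⟩
  · simp only [piece, top_l, len_l, shift, hbw, Set.mem_Ico, hlo] at hx ⊢
    exact ⟨⟨hx.1, by linarith⟩, by linarith, by linarith⟩
  · simp only [piece, top_l, len_l, shift, hbw, htl, Set.mem_Ico, hlo] at hx ⊢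
    exact ⟨⟨by linarith, by linarith⟩, by linarith, by linarith⟩
  · simp only [shift, top_l, bot_l, hbw, htl]; ring
  · intro i hi x hx
    by_cases hiw : i = w
    · subst hiw
      simp only [piece, top_w, len_w, Set.mem_Ico] at hx ⊢
      exact ⟨by linarith [hpos l], by linarith⟩
    · simpa only [piece, (hne i hiw hi).1, (hne i hiw hi).2.2] using hx
  · intro i hi
    by_cases hiw : i = w
    · subst hiw
      simp only [shift, top_w, bot_w, hbw]; ring
    · simp only [shift, (hne i hiw hi).1, (hne i hiw hi).2.1]

/-- Left induction where the interval that comes first is the longest. -/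
theorem Valid.induced_top (h : D.Valid) (hwl : w ≠ l) (htw : D.top w = D.lo) (hbl : D.bot l = D.lo)
    (hlt : D.len l < D.len w) (hlo : D₁.lo = D.lo + D.len l) (hhi : D₁.hi = D.hi)
    (bot_l : D₁.bot l = D.bot w) (bot_w : D₁.bot w = D.bot w + D.len l)
    (top_l : D₁.top l = D.top l) (top_w : D₁.top w = D.lo + D.len l)
    (len_l : D₁.len l = D.len l) (len_w : D₁.len w = D.len w - D.len l)
    (hne : ∀ i, i ≠ w → i ≠ l → D₁.top i = D.top i ∧ D₁.bot i = D.bot i ∧ D₁.len i = D.len i) :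
    Induced D D₁ l l w := by
  have hpos := h.len_pos
  have h₁ : D₁.Valid := by
    refine ⟨fun i => ?_, ?_, ?_⟩
    · by_cases hiw : i = w
      · subst hiw; rw [len_w]; linarith
      · by_cases hil : i = l
        · subst hil; rw [len_l]; exact hpos _
        · rw [(hne i hiw hil).2.2]; exact hpos _
    · rw [hlo, hhi]
      refine h.tiling_top.trim (hpos l).le htw hlt top_w len_w fun i hi => ?_
      by_cases hil : i = l
      · subst hil; exact ⟨top_l, len_l⟩
      · exact ⟨(hne i hi hil).1, (hne i hi hil).2.2⟩
    · rw [hlo, hhi]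
      exact h.tiling_bot.replace hwl hbl (hpos l) hlt bot_l bot_w len_l len_w
        fun i h1 h2 => ⟨(hne i h1 h2).2.1, (hne i h1 h2).2.2⟩
  refine ⟨h, h₁, hhi, by linarith [hpos l], fun x hx => ?_, fun x hx => ?_, ?_, ?_, ?_, Or.inl rfl⟩
  · simp only [piece, top_l, len_l, shift, hbl, Set.mem_Ico, hlo] at hx ⊢
    exact ⟨hx, by linarith, by linarith⟩
  · simp only [piece, top_l, len_l, shift, hbl, htw, Set.mem_Ico, hlo] at hx ⊢
    exact ⟨⟨by linarith, by linarith⟩, by linarith, by linarith⟩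
  · simp only [shift, top_l, bot_l, hbl, htw]; ring
  · intro i hi x hx
    by_cases hiw : i = w
    · subst hiw
      simp only [piece, top_w, len_w, htw, Set.mem_Ico] at hx ⊢
      exact ⟨by linarith [hpos l], by linarith⟩
    · simpa only [piece, (hne i hiw hi).1, (hne i hiw hi).2.2] using hx
  · intro i hi
    by_cases hiw : i = w
    · subst hiw
      simp only [shift, top_w, bot_w, htw]; ring
    · simp only [shift, (hne i hiw hi).1, (hne i hiw hi).2.1]

end Moves

/-- Every orbit visits `F` within a bounded time. -/
def Recurrent (D : Exchange ι) (F : Set ℝ) : Prop :=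
  ∃ N, ∀ y ∈ D.dom, ∃ t ≤ N, D.map^[t] y ∈ F

theorem Recurrent.mono {F F' : Set ℝ} (h : D.Recurrent F) (hF : F ⊆ F') : D.Recurrent F' := by
  obtain ⟨N, hN⟩ := h
  refine ⟨N, fun y hy => ?_⟩
  obtain ⟨t, ht, h⟩ := hN y hy
  exact ⟨t, ht, hF h⟩

namespace Induced

variable {l v m : ι}

theorem mem_dom_or (h : Induced D D₁ l v m) {x : ℝ} (hx : x ∈ D.dom) :
    x ∈ D₁.dom ∨ x ∈ Set.Ico D.lo D₁.lo := by
  rcases le_or_gt D₁.lo x with hlo | hlo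
  · exact Or.inl ⟨hlo, by rw [h.hi_eq]; exact hx.2⟩
  · exact Or.inr ⟨hx.1, hlo⟩

theorem map_map_of_mem_l (h : Induced D D₁ l v m) {x : ℝ} (hx : x ∈ D₁.piece l) :
    D.map (D.map x) = D₁.map x := by
  obtain ⟨h1, h2⟩ := h.piece_l x hx
  rw [h.valid.map_eq h1, h.valid.map_eq (h.cut _ h2).2, h.valid₁.map_eq hx, h.shift_l, add_assoc]

theorem map_of_ne (h : Induced D D₁ l v m) {i : ι} (hi : i ≠ l) {x : ℝ} (hx : x ∈ D₁.piece i) :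
    D.map x = D₁.map x := by
  rw [h.valid.map_eq (h.piece_ne i hi x hx), h.valid₁.map_eq hx, h.shift_ne i hi]

theorem map_cut_mem (h : Induced D D₁ l v m) {x : ℝ} (hx : x ∈ Set.Ico D.lo D₁.lo) :
    D.map x ∈ D₁.dom := by
  obtain ⟨h1, h2⟩ := h.cut x hx
  have h3 := h.valid₁.map_mem (h.valid₁.piece_subset h1)
  rw [h.valid₁.map_eq h1, h.shift_l] at h3
  rw [h.valid.map_eq h2]
  convert h3 using 1
  ring

theorem exists_iterate_eq (h : Induced D D₁ l v m) {x : ℝ} (hx : x ∈ D₁.dom) (t : ℕ) :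
    ∃ s ≤ 2 * t, D.map^[s] x = D₁.map^[t] x := by
  induction t with
  | zero => exact ⟨0, le_rfl, rfl⟩
  | succ t ih =>
    obtain ⟨s, hs, he⟩ := ih
    obtain ⟨i, hi⟩ := h.valid₁.exists_piece (h.valid₁.iterate_mem hx t)
    by_cases hil : i = l
    · subst hil
      refine ⟨s + 2, by omega, ?_⟩
      rw [Function.iterate_succ_apply', Function.iterate_succ_apply', Function.iterate_succ_apply',
        he, h.map_map_of_mem_l hi]
    · refine ⟨s + 1, by omega, ?_⟩
      rw [Function.iterate_succ_apply', Function.iterate_succ_apply', he, h.map_of_ne hil hi]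

theorem recurrent (h : Induced D D₁ l v m) {F : Set ℝ} (hF : D₁.Recurrent F) : D.Recurrent F := by
  obtain ⟨N, hN⟩ := hF
  have key : ∀ y ∈ D₁.dom, ∃ t ≤ 2 * N, D.map^[t] y ∈ F := by
    intro y hy
    obtain ⟨t, ht, hty⟩ := hN y hy
    obtain ⟨s, hs, he⟩ := h.exists_iterate_eq hy t
    exact ⟨s, by omega, by rwa [he]⟩
  refine ⟨2 * N + 1, fun y hy => ?_⟩
  rcases h.mem_dom_or hy with hy | hy
  · obtain ⟨t, ht, hty⟩ := key y hy
    exact ⟨t, by omega, hty⟩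
  · obtain ⟨t, ht, hty⟩ := key _ (h.map_cut_mem hy)
    exact ⟨t + 1, by omega, by rwa [Function.iterate_succ_apply]⟩

/-- One more iteration carries a visit to `F` into its translate, because `F` lies inside the piece
`v` of `D`. -/
theorem recurrent_image (h : Induced D D₁ l v m) {F : Set ℝ} (hF : D₁.Recurrent F)
    (hsub : F ⊆ D₁.piece l) : D.Recurrent ((fun x => x + D.shift v) '' F) := by
  obtain ⟨N, hN⟩ := h.recurrent hF
  refine ⟨N + 1, fun y hy => ?_⟩
  obtain ⟨t, ht, hty⟩ := hN y hy
  refine ⟨t + 1, by omega, D.map^[t] y, hty, ?_⟩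
  rw [Function.iterate_succ_apply', h.valid.map_eq (h.piece_l _ (hsub hty)).1]

end Induced

/-- The orbits visit the union of the pieces in `S`. -/
def Visits (D : Exchange ι) (S : Set ι) : Prop := D.Recurrent {x | ∃ i ∈ S, x ∈ D.piece i}

theorem Valid.visits_univ (h : D.Valid) : D.Visits Set.univ :=
  ⟨0, fun y hy => ⟨0, le_rfl, by
    obtain ⟨i, hi⟩ := h.exists_piece hy
    exact ⟨i, trivial, hi⟩⟩⟩

/-- A visit to the piece `l` of `D₁` is a visit to the piece `v` of `D`, followed one step later by
a visit to `m`. So in the set of visited letters `l` may be exchanged for either one. -/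
theorem Induced.visits {l v m k : ι} (h : Induced D D₁ l v m) {S S' : Set ι} (hS : D₁.Visits S)
    (hk : k = v ∨ k = m) (hS' : ∀ i ∈ S, i ≠ l → i ∈ S') (hl : l ∈ S → k ∈ S') : D.Visits S' := by
  rcases hk with rfl | rfl
  · refine (h.recurrent hS).mono ?_
    rintro x ⟨i, hi, hx⟩
    by_cases hil : i = l
    · subst hil
      exact ⟨k, hl hi, (h.piece_l x hx).1⟩
    · exact ⟨i, hS' i hi hil, h.piece_ne i hil x hx⟩
  · obtain ⟨N, hN⟩ := h.recurrent hS
    refine ⟨N + 1, fun y hy => ?_⟩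
    obtain ⟨t, ht, i, hi, hx⟩ := hN y hy
    by_cases hil : i = l
    · subst hil
      refine ⟨t + 1, by omega, k, hl hi, ?_⟩
      rw [Function.iterate_succ_apply', h.valid.map_eq (h.piece_l _ hx).1]
      exact (h.cut _ (h.piece_l _ hx).2).2
    · exact ⟨t, by omega, i, hS' i hi hil, h.piece_ne i hil _ hx⟩

theorem Induced.visits_same {l v m : ι} (h : Induced D D₁ l v m) {S : Set ι} (hS : D₁.Visits S) :
    D.Visits S := by
  refine h.visits (k := l) hS ?_ (fun i hi _ => hi) id
  rcases h.loser with h | h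
  · exact Or.inl h.symm
  · exact Or.inr h.symm

/-- Every point lies in an `ε`-small subset of a piece which all orbits visit. -/
def Fine (D : Exchange ι) (ε : ℝ) : Prop :=
  ∀ x ∈ D.dom, ∃ F : Set ℝ, x ∈ F ∧ (∀ y ∈ F, |y - x| ≤ ε) ∧ (∃ i, F ⊆ D.piece i) ∧ D.Recurrent F

/-- The cut part of the domain is a translate of the piece `l` of `D₁`, so small recurrent sets are
translated there without growing. -/
theorem Induced.fine {l v m : ι} (h : Induced D D₁ l v m) {ε : ℝ} (hε : D₁.Fine ε) : D.Fine ε := by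
  intro x hx
  rcases h.mem_dom_or hx with hx | hx
  · obtain ⟨F, hxF, hF, ⟨i, hi⟩, hrec⟩ := hε x hx
    refine ⟨F, hxF, hF, ?_, h.recurrent hrec⟩
    by_cases hil : i = l
    · subst hil
      exact ⟨v, fun y hy => (h.piece_l y (hi hy)).1⟩
    · exact ⟨i, fun y hy => h.piece_ne i hil y (hi hy)⟩
  · have hz := (h.cut x hx).1
    obtain ⟨F, hxF, hF, ⟨i, hi⟩, hrec⟩ := hε _ (h.valid₁.piece_subset hz)
    obtain rfl := h.valid₁.piece_unique (hi hxF) hz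
    refine ⟨(fun x => x + D.shift v) '' F, ⟨_, hxF, by ring⟩, ?_, ⟨m, ?_⟩,
      h.recurrent_image hrec hi⟩
    · rintro _ ⟨y, hy, rfl⟩
      have := hF y hy
      rwa [show y + D.shift v - x = y - (x - D.shift v) by ring]
    · rintro _ ⟨y, hy, rfl⟩
      exact (h.cut _ (h.piece_l y (hi hy)).2).2

theorem Valid.fine (h : D.Valid) (hvis : ∀ i, D.Visits {i}) : D.Fine (D.hi - D.lo) := by
  intro x hx
  obtain ⟨i, hi⟩ := h.exists_piece hx
  refine ⟨D.piece i, hi, fun y hy => ?_, ⟨i, subset_rfl⟩, Recurrent.mono (hvis i) ?_⟩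
  · have := h.piece_subset hy
    rw [abs_le]
    exact ⟨by linarith [hx.1, hx.2, this.1, this.2], by linarith [hx.1, hx.2, this.1, this.2]⟩
  · rintro y ⟨j, rfl, hy⟩
    exact hy

end Exchange

end FlipIET

/-! ### Semiconjugacy of two exchanges with the same induction path -/

namespace FlipIET

namespace Exchange

variable {ι : Type*}

/-- `φ` maps the pieces of `D'` to those of `D`. -/
def Respects (D' D : Exchange ι) (φ : ℝ → ℝ) : Prop := ∀ i, ∀ x ∈ D'.piece i, φ x ∈ D.piece i

/-- `φ` conjugates `D'` to `D` up to an error `ε`. -/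
def AlmostCommutes (D' D : Exchange ι) (φ : ℝ → ℝ) (ε : ℝ) : Prop :=
  ∀ i, ∀ x ∈ D'.piece i, |φ (x + D'.shift i) - (φ x + D.shift i)| ≤ ε

def Separates (D' : Exchange ι) (φ : ℝ → ℝ) (ε : ℝ) : Prop :=
  ∀ x ∈ D'.dom, ∀ z ∈ D'.dom, ε < |x - z| → φ x ≠ φ z

/-- The values of `ψ` lie above those of `φ`, but not above the next larger value of `φ`. -/
def Refines (D' : Exchange ι) (φ ψ : ℝ → ℝ) : Prop :=
  ∀ x ∈ D'.dom, ∀ z ∈ D'.dom, φ x ≤ ψ x ∧ (φ x < φ z → ψ x ≤ φ z)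

/-- An operator that lifts maps between two induced transformations to maps between the
transformations themselves. -/
structure IsLift (D' D D₁' D₁ : Exchange ι) (Λ : (ℝ → ℝ) → ℝ → ℝ) : Prop where
  measurable : ∀ φ, Measurable φ → Measurable (Λ φ)
  respects : ∀ φ, Respects D₁' D₁ φ → Respects D' D (Λ φ)
  commutes : ∀ φ ε, 0 ≤ ε → Respects D₁' D₁ φ → AlmostCommutes D₁' D₁ φ ε →
    AlmostCommutes D' D (Λ φ) ε
  separates : ∀ φ ε, Respects D₁' D₁ φ → Separates D₁' φ ε → Separates D' (Λ φ) ε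
  refines : ∀ φ ψ, Respects D₁' D₁ φ → Respects D₁' D₁ ψ → Refines D₁' φ ψ →
    Refines D' (Λ φ) (Λ ψ)

theorem IsLift.id (D' D : Exchange ι) : IsLift D' D D' D id :=
  ⟨fun _ h => h, fun _ h => h, fun _ _ _ _ h => h, fun _ _ _ h => h, fun _ _ _ _ h => h⟩

theorem IsLift.comp {D' D D₁' D₁ D₂' D₂ : Exchange ι} {Λ Λ₁ : (ℝ → ℝ) → ℝ → ℝ}
    (h : IsLift D' D D₁' D₁ Λ) (h₁ : IsLift D₁' D₁ D₂' D₂ Λ₁) :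
    IsLift D' D D₂' D₂ (Λ ∘ Λ₁) where
  measurable φ hφ := h.measurable _ (h₁.measurable φ hφ)
  respects φ hφ := h.respects _ (h₁.respects φ hφ)
  commutes φ ε h0 hφ hc := h.commutes _ ε h0 (h₁.respects φ hφ) (h₁.commutes φ ε h0 hφ hc)
  separates φ ε hφ hs := h.separates _ ε (h₁.respects φ hφ) (h₁.separates φ ε hφ hs)
  refines φ ψ hφ hψ hr := h.refines _ _ (h₁.respects φ hφ) (h₁.respects ψ hψ)
    (h₁.refines φ ψ hφ hψ hr)

section Lift

variable {D' D D₁' D₁ : Exchange ι} {l v m : ι}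

/-- The cut part is the upper floor of the return tower over the piece `l`, and the lift is defined
there by translating `φ` up one floor. It therefore commutes exactly on the way up, and the error of
`φ` occurs only on the way down. Values on the cut stay below `D₁.lo` and the others do not, so
order and separation survive. -/
theorem Induced.isLift (h' : Induced D' D₁' l v m) (h : Induced D D₁ l v m) :
    IsLift D' D D₁' D₁ fun φ x =>
      if x < D₁'.lo then φ (x - D'.shift v) + D.shift v else φ x := by
  have dom_of_resp : ∀ {φ}, Respects D₁' D₁ φ → ∀ x ∈ D₁'.dom, φ x ∈ D₁.dom := by
    intro φ hφ x hx
    obtain ⟨i, hi⟩ := h'.valid₁.exists_piece hx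
    exact h.valid₁.piece_subset (hφ i x hi)
  have cut_val : ∀ {φ}, Respects D₁' D₁ φ → ∀ x ∈ Set.Ico D'.lo D₁'.lo,
      φ (x - D'.shift v) + D.shift v ∈ Set.Ico D.lo D₁.lo := by
    intro φ hφ x hx
    exact (h.piece_l _ (hφ l _ (h'.cut x hx).1)).2
  refine ⟨fun φ hφ => ?_, fun φ hφ i x hx => ?_, fun φ ε h0 hφ hc i x hx => ?_,
    fun φ ε hφ hs x hx z hz hxz => ?_, fun φ ψ hφ hψ hr x hx z hz => ?_⟩
  · exact Measurable.ite measurableSet_Iio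
      ((hφ.comp (measurable_id.sub_const _)).add_const _) hφ
  · rcases h'.mem_dom_or (h'.valid.piece_subset hx) with hx1 | hx1
    · simp only [not_lt.2 hx1.1, if_false]
      obtain ⟨j, hj⟩ := h'.valid₁.exists_piece hx1
      by_cases hjl : j = l
      · subst hjl
        obtain rfl := h'.valid.piece_unique hx (h'.piece_l x hj).1
        exact (h.piece_l _ (hφ j x hj)).1
      · obtain rfl := h'.valid.piece_unique hx (h'.piece_ne j hjl x hj)
        exact h.piece_ne i hjl _ (hφ i x hj)
    · simp only [hx1.2, if_true]
      obtain rfl := h'.valid.piece_unique hx (h'.cut x hx1).2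
      exact (h.cut _ (cut_val hφ x hx1)).2
  · rcases h'.mem_dom_or (h'.valid.piece_subset hx) with hx1 | hx1
    · obtain ⟨j, hj⟩ := h'.valid₁.exists_piece hx1
      by_cases hjl : j = l
      · subst hjl
        obtain ⟨h1, h2⟩ := h'.piece_l x hj
        obtain rfl := h'.valid.piece_unique hx h1
        simp only [not_lt.2 hx1.1, if_false, h2.2, if_true, add_sub_cancel_right, sub_self,
          abs_zero, h0]
      · obtain rfl := h'.valid.piece_unique hx (h'.piece_ne j hjl x hj)
        have h2 := h'.valid₁.add_shift_mem_dom hj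
        have h3 := hc i x hj
        rw [h'.shift_ne i hjl] at h2 h3
        rw [h.shift_ne i hjl] at h3
        simpa only [not_lt.2 hx1.1, if_false, not_lt.2 h2.1] using h3
    · obtain ⟨h1, h2⟩ := h'.cut x hx1
      obtain rfl := h'.valid.piece_unique hx h2
      have h3 := hc l _ h1
      have h4 := h'.valid₁.add_shift_mem_dom h1
      rw [h'.shift_l, show x - D'.shift v + (D'.shift v + D'.shift i) = x + D'.shift i by ring]
        at h3 h4
      rw [h.shift_l] at h3
      simpa only [not_lt.2 h4.1, if_false, hx1.2, if_true, add_assoc] using h3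
  · rcases h'.mem_dom_or hx with hx1 | hx1 <;> rcases h'.mem_dom_or hz with hz1 | hz1
    · simpa only [not_lt.2 hx1.1, not_lt.2 hz1.1, if_false] using hs x hx1 z hz1 hxz
    · simp only [not_lt.2 hx1.1, hz1.2, if_false, if_true]
      have h1 := cut_val hφ z hz1
      have h2 := dom_of_resp hφ x hx1
      exact ne_of_gt (h1.2.trans_le h2.1)
    · simp only [not_lt.2 hz1.1, hx1.2, if_false, if_true]
      have h1 := cut_val hφ x hx1
      have h2 := dom_of_resp hφ z hz1
      exact ne_of_lt (h1.2.trans_le h2.1)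
    · simp only [hz1.2, hx1.2, if_true]
      have := hs _ (h'.valid₁.piece_subset (h'.cut x hx1).1) _
        (h'.valid₁.piece_subset (h'.cut z hz1).1) (by rwa [sub_sub_sub_cancel_right])
      exact fun he => this (add_right_cancel he)
  · rcases h'.mem_dom_or hx with hx1 | hx1 <;> rcases h'.mem_dom_or hz with hz1 | hz1
    · simpa only [not_lt.2 hx1.1, not_lt.2 hz1.1, if_false] using hr x hx1 z hz1
    · simp only [not_lt.2 hx1.1, hz1.2, if_false, if_true]
      have h1 := cut_val hφ z hz1
      have h2 := dom_of_resp hφ x hx1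
      exact ⟨(hr x hx1 x hx1).1, fun hlt => absurd hlt (not_lt.2 (h1.2.trans_le h2.1).le)⟩
    · simp only [not_lt.2 hz1.1, hx1.2, if_false, if_true]
      have h1 := cut_val hψ x hx1
      have h2 := dom_of_resp hφ z hz1
      have h3 := h'.valid₁.piece_subset (h'.cut x hx1).1
      exact ⟨by linarith [(hr _ h3 _ h3).1], fun _ => (h1.2.trans_le h2.1).le⟩
    · simp only [hz1.2, hx1.2, if_true]
      have := hr _ (h'.valid₁.piece_subset (h'.cut x hx1).1) _
        (h'.valid₁.piece_subset (h'.cut z hz1).1)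
      exact ⟨by linarith [this.1], fun hlt => by linarith [this.2 (by linarith)]⟩

end Lift

/-- One step of simultaneous induction of two transformations. -/
def PairStep (P Q : Exchange ι × Exchange ι) : Prop :=
  ∃ l v m, Induced P.1 Q.1 l v m ∧ Induced P.2 Q.2 l v m

theorem PairStep.intro {D' D D₁' D₁ : Exchange ι} {l v m : ι} (h' : Induced D' D₁' l v m)
    (h : Induced D D₁ l v m) : PairStep (D', D) (D₁', D₁) :=
  ⟨l, v, m, h', h⟩

/-- Simultaneous induction of two transformations. -/
def PairPath : Exchange ι × Exchange ι → Exchange ι × Exchange ι → Prop :=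
  Relation.ReflTransGen PairStep

theorem PairPath.exists_isLift {P Q : Exchange ι × Exchange ι} (h : PairPath P Q) :
    ∃ Λ, IsLift P.1 P.2 Q.1 Q.2 Λ := by
  induction h with
  | refl => exact ⟨_, IsLift.id _ _⟩
  | tail _ h ih =>
    obtain ⟨Λ, hΛ⟩ := ih
    obtain ⟨l, v, m, h1, h2⟩ := h
    exact ⟨_, hΛ.comp (h1.isLift h2)⟩

theorem PairPath.fine {P Q : Exchange ι × Exchange ι} (h : PairPath P Q) {ε : ℝ}
    (hε : Q.1.Fine ε) : P.1.Fine ε := by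
  induction h with
  | refl => exact hε
  | tail _ h ih =>
    obtain ⟨l, v, m, h1, h2⟩ := h
    exact ih (h1.fine hε)

theorem PairPath.visits {P Q : Exchange ι × Exchange ι} (h : PairPath P Q) {S : Set ι}
    (hS : Q.1.Visits S) : P.1.Visits S := by
  induction h with
  | refl => exact hS
  | tail _ h ih =>
    obtain ⟨l, v, m, h1, h2⟩ := h
    exact ih (h1.visits_same hS)

section Limit

variable [Fintype ι]

/-- The map that sends each piece of `D'` to the left endpoint of the same piece of `D`. -/
noncomputable def endpointMap (D' D : Exchange ι) (x : ℝ) : ℝ :=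
  ∑ i, (D'.piece i).indicator (fun _ => D.top i) x

theorem Valid.endpointMap_eq {D' : Exchange ι} (h' : D'.Valid) (D : Exchange ι) {i : ι} {x : ℝ}
    (hx : x ∈ D'.piece i) : endpointMap D' D x = D.top i := by
  rw [endpointMap, Finset.sum_eq_single i, Set.indicator_of_mem hx]
  · intro j _ hj
    exact Set.indicator_of_notMem (fun hxj => hj (h'.piece_unique hxj hx)) _
  · simp

theorem measurable_endpointMap (D' D : Exchange ι) : Measurable (endpointMap D' D) :=
  Finset.measurable_sum _ fun _ _ => measurable_const.indicator measurableSet_Ico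

variable {D' D : Exchange ι}

theorem respects_endpointMap (h' : D'.Valid) (h : D.Valid) :
    Respects D' D (endpointMap D' D) := by
  intro i x hx
  rw [h'.endpointMap_eq D hx]
  exact h.top_mem i

theorem almostCommutes_endpointMap (h' : D'.Valid) (h : D.Valid) :
    AlmostCommutes D' D (endpointMap D' D) (D.hi - D.lo) := by
  intro i x hx
  obtain ⟨j, hj⟩ := h'.exists_piece (h'.add_shift_mem_dom hx)
  rw [h'.endpointMap_eq D hx, h'.endpointMap_eq D hj]
  have h1 := h.piece_subset (h.top_mem j)
  have h2 := h.add_shift_mem_dom (h.top_mem i)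
  rw [abs_le]
  constructor <;> linarith [h1.1, h1.2, h2.1, h2.2]

theorem separates_endpointMap (D' D : Exchange ι) :
    Separates D' (endpointMap D' D) (D'.hi - D'.lo) := by
  intro x hx z hz hlt
  refine absurd hlt (not_lt.2 ?_)
  rw [abs_le]
  constructor <;> linarith [hx.1, hx.2, hz.1, hz.2]

/-- Any `ψ` that respects the pieces takes its value in the half-open piece starting at the value of
`endpointMap`, and the next value starts a later piece. -/
theorem refines_endpointMap (h' : D'.Valid) (h : D.Valid) {ψ : ℝ → ℝ} (hψ : Respects D' D ψ) :
    Refines D' (endpointMap D' D) ψ := by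
  intro x hx z hz
  obtain ⟨i, hi⟩ := h'.exists_piece hx
  obtain ⟨j, hj⟩ := h'.exists_piece hz
  rw [h'.endpointMap_eq D hi, h'.endpointMap_eq D hj]
  have h1 := hψ i x hi
  refine ⟨h1.1, fun hlt => ?_⟩
  by_contra! hgt
  have h2 : D.top j ∈ D.piece i := ⟨hlt.le, hgt.trans h1.2⟩
  rw [h.piece_unique h2 (h.top_mem j)] at hlt
  exact lt_irrefl _ hlt

open Filter Topology in
/-- Two transformations with the same infinite sequence of inductions are semiconjugate. -/
theorem exists_semiconj (S : ℕ → Exchange ι × Exchange ι) (hvalid' : ∀ k, (S k).1.Valid)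
    (hvalid : ∀ k, (S k).2.Valid) (hpath : ∀ k, PairPath (S k) (S (k + 1)))
    (hlim' : Tendsto (fun k => (S k).1.hi - (S k).1.lo) atTop (𝓝 0))
    (hlim : Tendsto (fun k => (S k).2.hi - (S k).2.lo) atTop (𝓝 0)) :
    ∃ φ : ℝ → ℝ, Measurable φ ∧
      (∀ i, ∀ x ∈ (S 0).1.piece i,
        φ x ∈ Set.Icc ((S 0).2.top i) ((S 0).2.top i + (S 0).2.len i)) ∧
      (∀ i, ∀ x ∈ (S 0).1.piece i, φ (x + (S 0).1.shift i) = φ x + (S 0).2.shift i) ∧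
      ∀ c, {x ∈ (S 0).1.dom | φ x = c}.Finite := by
  choose Λ hΛ using fun k => (hpath k).exists_isLift
  -- The lift from level N down to level 0.
  let C : ℕ → (ℝ → ℝ) → ℝ → ℝ := fun N => Nat.rec id (fun k f => f ∘ Λ k) N
  have C_succ : ∀ N φ, C (N + 1) φ = C N (Λ N φ) := fun N φ => rfl
  have hC : ∀ N, IsLift (S 0).1 (S 0).2 (S N).1 (S N).2 (C N) := by
    intro N
    induction N with
    | zero => exact IsLift.id _ _
    | succ N ih => exact ih.comp (hΛ N)
  -- Everything lifted from a deeper level passes through level N as a map respecting the pieces, so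
  -- the endpoint maps of different levels can be compared at level N.
  have factor : ∀ N r φ, Respects (S (N + r)).1 (S (N + r)).2 φ →
      ∃ ψ, Respects (S N).1 (S N).2 ψ ∧ C (N + r) φ = C N ψ := by
    intro N r
    induction r with
    | zero => exact fun φ hφ => ⟨φ, hφ, rfl⟩
    | succ r ih =>
      intro φ hφ
      obtain ⟨ψ, h1, h2⟩ := ih _ ((hΛ (N + r)).respects φ hφ)
      exact ⟨ψ, h1, h2⟩
  set B : ℕ → ℝ → ℝ := fun N => endpointMap (S N).1 (S N).2
  have hB : ∀ N, Respects (S N).1 (S N).2 (B N) := fun N =>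
    respects_endpointMap (hvalid' N) (hvalid N)
  set Φ : ℕ → ℝ → ℝ := fun N => C N (B N)
  have hresp : ∀ N, Respects (S 0).1 (S 0).2 (Φ N) := fun N => (hC N).respects _ (hB N)
  have hrefines : ∀ N M, N ≤ M → Refines (S 0).1 (Φ N) (Φ M) := by
    intro N M hNM
    obtain ⟨r, rfl⟩ := Nat.exists_eq_add_of_le hNM
    obtain ⟨ψ, h1, h2⟩ := factor N r _ (hB (N + r))
    change Refines (S 0).1 (C N (B N)) (C (N + r) (B (N + r)))
    rw [h2]
    exact (hC N).refines _ _ (hB N) h1 (refines_endpointMap (hvalid' N) (hvalid N) h1)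
  have hmem : ∀ N, ∀ x ∈ (S 0).1.dom, Φ N x ∈ (S 0).2.dom := by
    intro N x hx
    obtain ⟨i, hi⟩ := (hvalid' 0).exists_piece hx
    exact (hvalid 0).piece_subset (hresp N i x hi)
  -- Cutting off outside of the domain makes the sequence converge everywhere, as measurability of
  -- the limit requires.
  set Ψ : ℕ → ℝ → ℝ := fun N => (S 0).1.dom.indicator (Φ N)
  have hΨ : ∀ N, ∀ x ∈ (S 0).1.dom, Ψ N x = Φ N x := fun N x hx => Set.indicator_of_mem hx _
  have hmono : ∀ x ∈ (S 0).1.dom, Monotone fun N => Φ N x :=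
    fun x hx N M hNM => (hrefines N M hNM x hx x hx).1
  set φ : ℝ → ℝ := fun x => ⨆ N, Ψ N x
  have htend : ∀ x ∈ (S 0).1.dom, Tendsto (fun N => Φ N x) atTop (𝓝 (φ x)) := by
    intro x hx
    have : φ x = ⨆ N, Φ N x := by
      simp only [φ, hΨ _ x hx]
    rw [this]
    refine tendsto_atTop_ciSup (hmono x hx) ⟨(S 0).2.hi, ?_⟩
    rintro _ ⟨N, rfl⟩
    exact (hmem N x hx).2.le
  have htend' : ∀ x, Tendsto (fun N => Ψ N x) atTop (𝓝 (φ x)) := by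
    intro x
    by_cases hx : x ∈ (S 0).1.dom
    · simpa only [hΨ _ x hx] using htend x hx
    · have h0 : ∀ N, Ψ N x = 0 := fun N => Set.indicator_of_notMem hx _
      simp only [φ, h0, ciSup_const, tendsto_const_nhds]
  refine ⟨φ, ?_, ?_, ?_, ?_⟩
  · refine measurable_of_tendsto_metrizable (f := Ψ) (fun N => ?_) (tendsto_pi_nhds.2 htend')
    exact ((hC N).measurable _ (measurable_endpointMap _ _)).indicator measurableSet_Ico
  · intro i x hx
    refine isClosed_Icc.mem_of_tendsto (htend x ((hvalid' 0).piece_subset hx))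
      (Eventually.of_forall fun N => Set.Ico_subset_Icc_self (hresp N i x hx))
  · intro i x hx
    have h1 := htend x ((hvalid' 0).piece_subset hx)
    have h2 := htend _ ((hvalid' 0).add_shift_mem_dom hx)
    have h3 : Tendsto (fun N => |Φ N (x + (S 0).1.shift i) - (Φ N x + (S 0).2.shift i)|) atTop
        (𝓝 0) := by
      refine squeeze_zero (fun N => abs_nonneg _) (fun N => ?_) hlim
      refine (hC N).commutes _ _ ?_ (hB N)
        (almostCommutes_endpointMap (hvalid' N) (hvalid N)) i x hx
      have := (hvalid N).piece_subset ((hvalid N).top_mem i)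
      linarith [this.1, this.2]
    have h4 := tendsto_nhds_unique (h2.sub (h1.add_const _)).abs h3
    linarith [abs_eq_zero.1 h4]
  · intro c
    -- Fibres have at most two points: three points are eventually separated by `Φ N`, say with
    -- increasing values at u, v, w, and then φ u ≤ Φ N v < Φ N w ≤ φ w.
    by_contra hinf
    obtain ⟨t, hts, htc⟩ := Set.Infinite.exists_subset_card_eq hinf 3
    obtain ⟨x, y, z, hxy, hxz, hyz, rfl⟩ := Finset.card_eq_three.1 htc
    have hx := hts (by simp : x ∈ _)
    have hy := hts (by simp : y ∈ _)
    have hz := hts (by simp : z ∈ _)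
    have hev : ∀ p q : ℝ, p ≠ q → ∀ᶠ k in atTop, (S k).1.hi - (S k).1.lo < |p - q| :=
      fun p q hpq => hlim'.eventually_lt_const (abs_pos.2 (sub_ne_zero.2 hpq))
    obtain ⟨N, h1, h2, h3⟩ := ((hev x y hxy).and ((hev x z hxz).and (hev y z hyz))).exists
    have hsep := (hC N).separates _ _ (hB N) (separates_endpointMap (S N).1 (S N).2)
    have g1 : Φ N x ≠ Φ N y := hsep x hx.1 y hy.1 h1
    have g2 : Φ N x ≠ Φ N z := hsep x hx.1 z hz.1 h2
    have g3 : Φ N y ≠ Φ N z := hsep y hy.1 z hz.1 h3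
    have key : ∀ u ∈ (S 0).1.dom, ∀ v ∈ (S 0).1.dom, Φ N u < Φ N v → φ u ≤ Φ N v := by
      intro u hu v hv huv
      refine le_of_tendsto (htend u hu) ?_
      filter_upwards [eventually_ge_atTop N] with M hM
      exact (hrefines N M hM u hu v hv).2 huv
    have low : ∀ u ∈ (S 0).1.dom, Φ N u ≤ φ u := by
      intro u hu
      refine ge_of_tendsto (htend u hu) ?_
      filter_upwards [eventually_ge_atTop N] with M hM
      exact hmono u hu hM
    have fin : ∀ u v w, u ∈ {x ∈ (S 0).1.dom | φ x = c} → v ∈ {x ∈ (S 0).1.dom | φ x = c} →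
        w ∈ {x ∈ (S 0).1.dom | φ x = c} → Φ N u < Φ N v → Φ N v < Φ N w → False := by
      intro u v w hu hv hw huv hvw
      have e1 := key u hu.1 v hv.1 huv
      have e2 := low w hw.1
      rw [hu.2] at e1
      rw [hw.2] at e2
      linarith
    rcases lt_or_gt_of_ne g1 with g1 | g1 <;> rcases lt_or_gt_of_ne g2 with g2 | g2 <;>
      rcases lt_or_gt_of_ne g3 with g3 | g3
    · exact fin x y z hx hy hz g1 g3
    · exact fin x z y hx hz hy g2 g3
    · linarith
    · exact fin z x y hz hx hy g2 g1
    · exact fin y x z hy hx hz g1 g2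
    · linarith
    · exact fin y z x hy hz hx g3 g2
    · exact fin z y x hz hy hx g3 g1

end Limit

end Exchange

end FlipIET

/-! ### Invariant measures obtained from a semiconjugacy -/

namespace FlipIET

namespace Exchange

open MeasureTheory

theorem measurableSet_piece {ι : Type*} (D : Exchange ι) (i : ι) : MeasurableSet (D.piece i) :=
  measurableSet_Ico

variable {ι : Type*} [Fintype ι] {D' D : Exchange ι}

theorem Valid.measurable_map (h : D.Valid) : Measurable D.map := by
  have : D.map = fun x => x + ∑ i, (D.piece i).indicator (fun _ => D.shift i) x := by
    funext x
    by_cases hx : ∃ i, x ∈ D.piece i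
    · obtain ⟨i, hi⟩ := hx
      rw [h.map_eq hi, Finset.sum_eq_single i, Set.indicator_of_mem hi]
      · intro j _ hj
        exact Set.indicator_of_notMem (fun hxj => hj (h.piece_unique hxj hi)) _
      · simp
    · rw [map, dif_neg hx, Finset.sum_eq_zero, add_zero]
      intro j _
      exact Set.indicator_of_notMem (fun hxj => hx ⟨j, hxj⟩) _
  rw [this]
  exact measurable_id.add (Finset.measurable_sum _ fun i _ =>
    measurable_const.indicator (D.measurableSet_piece i))

theorem _root_.FlipIET.IsTiling.volume_inter {lo hi : ℝ} {left len : ι → ℝ}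
    (h : IsTiling lo hi left len) {A : Set ℝ} (hA : MeasurableSet A) :
    volume (A ∩ Set.Ico lo hi) =
      ∑ i, volume (A ∩ Set.Ico (left i) (left i + len i)) := by
  have : A ∩ Set.Ico lo hi = ⋃ i, A ∩ Set.Ico (left i) (left i + len i) := by
    ext x
    simp only [Set.mem_inter_iff, Set.mem_iUnion]
    constructor
    · rintro ⟨h1, h2⟩
      obtain ⟨i, hi⟩ := h.cover x h2
      exact ⟨i, h1, hi⟩
    · rintro ⟨i, h1, h2⟩
      exact ⟨h1, h.sub i x h2⟩
  rw [this, measure_iUnion, tsum_fintype]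
  · intro i j hij
    refine Set.disjoint_left.2 fun x hx hx' => hij (h.disj i j x hx.2 hx'.2)
  · exact fun i => hA.inter measurableSet_Ico

/-- Each piece is translated onto an interval of the second tiling, so the sum over one tiling
becomes the sum over the other. -/
theorem Valid.volume_preimage (h : D.Valid) {A : Set ℝ} (hA : MeasurableSet A) :
    volume (D.map ⁻¹' A ∩ D.dom) = volume (A ∩ D.dom) := by
  unfold dom
  rw [h.tiling_top.volume_inter (h.measurable_map hA), h.tiling_bot.volume_inter hA]
  refine Finset.sum_congr rfl fun i _ => ?_
  rw [← measure_preimage_add_right volume (D.shift i)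
    (A ∩ Set.Ico (D.bot i) (D.bot i + D.len i))]
  congr 1
  ext x
  constructor
  · rintro ⟨h1, h2⟩
    refine ⟨?_, add_shift_mem h2⟩
    change x + D.shift i ∈ A
    rw [← h.map_eq h2]
    exact h1
  · rintro ⟨h1, h2, h3⟩
    have hx : x ∈ D.piece i := by
      unfold shift at h2 h3
      exact ⟨by linarith, by linarith⟩
    refine ⟨?_, hx⟩
    rw [Set.mem_preimage, h.map_eq hx]
    exact h1

/-- A semiconjugacy transports the Lebesgue measure to an invariant measure. -/
theorem exists_invariant_of_semiconj (h' : D'.Valid) (h : D.Valid) {φ : ℝ → ℝ}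
    (hφ : Measurable φ)
    (hpiece : ∀ i, ∀ x ∈ D'.piece i, φ x ∈ Set.Icc (D.top i) (D.top i + D.len i))
    (hcomm : ∀ i, ∀ x ∈ D'.piece i, φ (x + D'.shift i) = φ x + D.shift i)
    (hfin : ∀ c, {x ∈ D'.dom | φ x = c}.Finite) :
    ∃ μ : Measure ℝ, μ Set.univ = ENNReal.ofReal (D'.hi - D'.lo) ∧ μ D.domᶜ = 0 ∧
      (∀ c, μ {c} = 0) ∧ (∀ A, MeasurableSet A → μ (D.map ⁻¹' A) = μ A) ∧
      ∀ i, μ (D.piece i) = ENNReal.ofReal (D'.len i) := by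
  set ν := (volume : Measure ℝ).restrict D'.dom
  have hdom : MeasurableSet D'.dom := measurableSet_Ico
  have hnull : ∀ c, ν {x | φ x = c} = 0 := by
    intro c
    rw [Measure.restrict_apply' hdom]
    refine (Set.Finite.measure_zero ((hfin c).subset ?_) _)
    rintro x ⟨h1, h2⟩
    exact ⟨h2, h1⟩
  -- The closed piece contains its right endpoint, which belongs to another piece; finite fibres
  -- make the set of points sent there null.
  have hae : ∀ᵐ x ∂ν, ∃ i, x ∈ D'.piece i ∧ φ x ∈ D.piece i := by
    have h1 : ∀ᵐ x ∂ν, x ∈ D'.dom := ae_restrict_mem hdom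
    have h2 : ∀ᵐ x ∂ν, ∀ i, φ x ≠ D.top i + D.len i :=
      ae_all_iff.2 fun i => by
        rw [ae_iff]
        simpa only [not_not, ne_eq] using hnull _
    filter_upwards [h1, h2] with x hx hx2
    obtain ⟨i, hi⟩ := h'.exists_piece hx
    have := hpiece i x hi
    exact ⟨i, hi, this.1, lt_of_le_of_ne this.2 (hx2 i)⟩
  refine ⟨ν.map φ, ?_, ?_, ?_, ?_, ?_⟩
  · rw [Measure.map_apply hφ MeasurableSet.univ, Set.preimage_univ, Measure.restrict_apply_univ,
      dom, Real.volume_Ico]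
  · rw [Measure.map_apply hφ (show MeasurableSet D.domᶜ from measurableSet_Ico.compl)]
    refine measure_mono_null (t := {x | ¬ ∃ i, x ∈ D'.piece i ∧ φ x ∈ D.piece i}) ?_ hae
    rintro x hx ⟨i, _, hi⟩
    exact hx (h.piece_subset hi)
  · intro c
    rw [Measure.map_apply hφ (measurableSet_singleton c)]
    exact hnull c
  · intro A hA
    rw [Measure.map_apply hφ (h.measurable_map hA), Measure.map_apply hφ hA]
    have h1 : ν (φ ⁻¹' (D.map ⁻¹' A)) = ν (D'.map ⁻¹' (φ ⁻¹' A)) := by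
      refine measure_congr ?_
      filter_upwards [hae] with x hx
      obtain ⟨i, hi, hi'⟩ := hx
      change (D.map (φ x) ∈ A) = (φ (D'.map x) ∈ A)
      rw [h.map_eq hi', h'.map_eq hi, hcomm i x hi]
    rw [h1, Measure.restrict_apply' hdom, Measure.restrict_apply' hdom,
      h'.volume_preimage (hφ hA)]
  · intro i
    rw [Measure.map_apply hφ (D.measurableSet_piece i)]
    have h1 : ν (φ ⁻¹' D.piece i) = ν (D'.piece i) := by
      refine measure_congr ?_
      filter_upwards [hae] with x hx
      obtain ⟨j, hj, hj'⟩ := hx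
      change (φ x ∈ D.piece i) = (x ∈ D'.piece i)
      refine propext ⟨fun hx => ?_, fun hx => ?_⟩
      · rwa [h.piece_unique hx hj']
      · rwa [h'.piece_unique hx hj]
    rw [h1, Measure.restrict_apply' hdom,
      Set.inter_eq_left.2 (fun x hx => h'.piece_subset hx), piece, Real.volume_Ico,
      add_sub_cancel_left]

end Exchange

end FlipIET

/-! ### The elementary induction steps starting from the reversal of four intervals -/

namespace FlipIET

theorem IsTiling.of_four {lo hi : ℝ} {left len : Fin 4 → ℝ} (hlen : ∀ i, 0 < len i) (a b c d : Fin 4)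
    (hall : ∀ i, i = a ∨ i = b ∨ i = c ∨ i = d) (ha : left a = lo) (hb : left b = left a + len a)
    (hc : left c = left b + len b) (hd : left d = left c + len c) (hhi : hi = left d + len d) :
    IsTiling lo hi left len := by
  have la := hlen a
  have lb := hlen b
  have lc := hlen c
  have ld := hlen d
  refine ⟨fun x hx => ?_, fun i x hx => ?_, fun i j x hi hj => ?_⟩
  · rcases lt_or_ge x (left b) with h1 | h1
    · exact ⟨a, by rw [ha]; exact hx.1, by rwa [← hb]⟩
    rcases lt_or_ge x (left c) with h2 | h2
    · exact ⟨b, h1, by rwa [← hc]⟩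
    rcases lt_or_ge x (left d) with h3 | h3
    · exact ⟨c, h2, by rwa [← hd]⟩
    · exact ⟨d, h3, by rw [← hhi]; exact hx.2⟩
  · obtain ⟨h1, h2⟩ := hx
    rcases hall i with rfl | rfl | rfl | rfl <;> constructor <;> linarith
  · obtain ⟨h1, h2⟩ := hi
    obtain ⟨h3, h4⟩ := hj
    rcases hall i with rfl | rfl | rfl | rfl <;> rcases hall j with rfl | rfl | rfl | rfl <;>
      first | rfl | (exfalso; linarith)

namespace Exchange

/-- The exchange of four intervals ending at `1`, ordered by the ranks `p` before and by the ranks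
`q` after the exchange. -/
noncomputable def ofRanks (p q : Fin 4 → ℕ) (x : Fin 4 → ℝ) : Exchange (Fin 4) where
  lo := 1 - ∑ i, x i
  hi := 1
  top i := 1 - ∑ i, x i + ∑ j, if p j < p i then x j else 0
  bot i := 1 - ∑ i, x i + ∑ j, if q j < q i then x j else 0
  len := x

/-- The exchange that reverses the order of the four intervals. -/
noncomputable abbrev reversal (x : Fin 4 → ℝ) : Exchange (Fin 4) :=
  ofRanks ![0, 1, 2, 3] ![3, 2, 1, 0] x

theorem reversal_valid {x : Fin 4 → ℝ} (hx : ∀ i, 0 < x i) : (reversal x).Valid := by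
  refine ⟨hx, ?_, ?_⟩
  · refine IsTiling.of_four hx 0 1 2 3 (by decide) ?_ ?_ ?_ ?_ ?_ <;>
      simp [ofRanks, Fin.sum_univ_four] <;> ring
  · refine IsTiling.of_four hx 3 2 1 0 (by decide) ?_ ?_ ?_ ?_ ?_ <;>
      simp [ofRanks, Fin.sum_univ_four] <;> ring

section Moves

variable {x₀ x₁ x₂ x₃ : ℝ}

theorem induced_a₁ (h : (reversal ![x₀, x₁, x₂, x₃ + x₀]).Valid) (h3 : 0 < x₃) :
    Induced (reversal ![x₀, x₁, x₂, x₃ + x₀])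
      (ofRanks ![2, 0, 1, 3] ![3, 2, 1, 0] ![x₀, x₁, x₂, x₃]) 0 3 0 := by
  refine h.induced_bot (w := 3) (l := 0) ?_ ?_ ?_ ?_ ?_ ?_ ?_ ?_ ?_ ?_ ?_ ?_ ?_
  case refine_13 =>
    intro i h1 h2
    fin_cases i <;> simp [ofRanks, Fin.sum_univ_four] at h1 h2 ⊢ <;>
      first | done | (refine ⟨?_, ?_⟩ <;> ring)
  all_goals simp [ofRanks, Fin.sum_univ_four]
  all_goals first | done | linarith

theorem induced_a₂ (h : (ofRanks ![2, 0, 1, 3] ![3, 2, 1, 0] ![x₀, x₁, x₂, x₃ + x₁]).Valid)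
    (h3 : 0 < x₃) :
    Induced (ofRanks ![2, 0, 1, 3] ![3, 2, 1, 0] ![x₀, x₁, x₂, x₃ + x₁])
      (ofRanks ![1, 2, 0, 3] ![3, 2, 1, 0] ![x₀, x₁, x₂, x₃]) 1 3 1 := by
  refine h.induced_bot (w := 3) (l := 1) ?_ ?_ ?_ ?_ ?_ ?_ ?_ ?_ ?_ ?_ ?_ ?_ ?_
  case refine_13 =>
    intro i h1 h2
    fin_cases i <;> simp [ofRanks, Fin.sum_univ_four] at h1 h2 ⊢ <;>
      first | done | (refine ⟨?_, ?_⟩ <;> ring)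
  all_goals simp [ofRanks, Fin.sum_univ_four]
  all_goals first | done | linarith

theorem induced_a₃ (h : (ofRanks ![1, 2, 0, 3] ![3, 2, 1, 0] ![x₀, x₁, x₂ + x₃, x₃]).Valid)
    (h2 : 0 < x₂) :
    Induced (ofRanks ![1, 2, 0, 3] ![3, 2, 1, 0] ![x₀, x₁, x₂ + x₃, x₃])
      (ofRanks ![1, 2, 0, 3] ![3, 2, 1, 0] ![x₀, x₁, x₂, x₃]) 3 3 2 := by
  refine h.induced_top (w := 2) (l := 3) ?_ ?_ ?_ ?_ ?_ ?_ ?_ ?_ ?_ ?_ ?_ ?_ ?_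
  case refine_13 =>
    intro i h1 h2
    fin_cases i <;> simp [ofRanks, Fin.sum_univ_four] at h1 h2 ⊢ <;>
      first | done | (refine ⟨?_, ?_⟩ <;> ring)
  all_goals simp [ofRanks, Fin.sum_univ_four]
  all_goals first | done | linarith

theorem induced_a₄ (h : (ofRanks ![1, 2, 0, 3] ![3, 2, 1, 0] ![x₀, x₁, x₂, x₃ + x₂]).Valid)
    (h3 : 0 < x₃) :
    Induced (ofRanks ![1, 2, 0, 3] ![3, 2, 1, 0] ![x₀, x₁, x₂, x₃ + x₂])
      (reversal ![x₀, x₁, x₂, x₃]) 2 3 2 := by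
  refine h.induced_bot (w := 3) (l := 2) ?_ ?_ ?_ ?_ ?_ ?_ ?_ ?_ ?_ ?_ ?_ ?_ ?_
  case refine_13 =>
    intro i h1 h2
    fin_cases i <;> simp [ofRanks, Fin.sum_univ_four] at h1 h2 ⊢ <;>
      first | done | (refine ⟨?_, ?_⟩ <;> ring)
  all_goals simp [ofRanks, Fin.sum_univ_four]
  all_goals first | done | linarith

theorem induced_b₁ (h : (reversal ![x₀ + x₃, x₁, x₂, x₃]).Valid) (h0 : 0 < x₀) :
    Induced (reversal ![x₀ + x₃, x₁, x₂, x₃])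
      (ofRanks ![0, 1, 2, 3] ![3, 1, 0, 2] ![x₀, x₁, x₂, x₃]) 3 3 0 := by
  refine h.induced_top (w := 0) (l := 3) ?_ ?_ ?_ ?_ ?_ ?_ ?_ ?_ ?_ ?_ ?_ ?_ ?_
  case refine_13 =>
    intro i h1 h2
    fin_cases i <;> simp [ofRanks, Fin.sum_univ_four] at h1 h2 ⊢ <;>
      first | done | (refine ⟨?_, ?_⟩ <;> ring)
  all_goals simp [ofRanks, Fin.sum_univ_four]
  all_goals first | done | linarith

theorem induced_b₂ (h : (ofRanks ![0, 1, 2, 3] ![3, 1, 0, 2] ![x₀ + x₂, x₁, x₂, x₃]).Valid)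
    (h0 : 0 < x₀) :
    Induced (ofRanks ![0, 1, 2, 3] ![3, 1, 0, 2] ![x₀ + x₂, x₁, x₂, x₃])
      (ofRanks ![0, 1, 2, 3] ![3, 0, 2, 1] ![x₀, x₁, x₂, x₃]) 2 2 0 := by
  refine h.induced_top (w := 0) (l := 2) ?_ ?_ ?_ ?_ ?_ ?_ ?_ ?_ ?_ ?_ ?_ ?_ ?_
  case refine_13 =>
    intro i h1 h2
    fin_cases i <;> simp [ofRanks, Fin.sum_univ_four] at h1 h2 ⊢ <;>
      first | done | (refine ⟨?_, ?_⟩ <;> ring)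
  all_goals simp [ofRanks, Fin.sum_univ_four]
  all_goals first | done | linarith

theorem induced_b₃ (h : (ofRanks ![0, 1, 2, 3] ![3, 0, 2, 1] ![x₀, x₁ + x₀, x₂, x₃]).Valid)
    (h1 : 0 < x₁) :
    Induced (ofRanks ![0, 1, 2, 3] ![3, 0, 2, 1] ![x₀, x₁ + x₀, x₂, x₃])
      (ofRanks ![0, 1, 2, 3] ![3, 0, 2, 1] ![x₀, x₁, x₂, x₃]) 0 1 0 := by
  refine h.induced_bot (w := 1) (l := 0) ?_ ?_ ?_ ?_ ?_ ?_ ?_ ?_ ?_ ?_ ?_ ?_ ?_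
  case refine_13 =>
    intro i h1 h2
    fin_cases i <;> simp [ofRanks, Fin.sum_univ_four] at h1 h2 ⊢ <;>
      first | done | (refine ⟨?_, ?_⟩ <;> ring)
  all_goals simp [ofRanks, Fin.sum_univ_four]
  all_goals first | done | linarith

theorem induced_b₄ (h : (ofRanks ![0, 1, 2, 3] ![3, 0, 2, 1] ![x₀ + x₁, x₁, x₂, x₃]).Valid)
    (h0 : 0 < x₀) :
    Induced (ofRanks ![0, 1, 2, 3] ![3, 0, 2, 1] ![x₀ + x₁, x₁, x₂, x₃])
      (reversal ![x₀, x₁, x₂, x₃]) 1 1 0 := by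
  refine h.induced_top (w := 0) (l := 1) ?_ ?_ ?_ ?_ ?_ ?_ ?_ ?_ ?_ ?_ ?_ ?_ ?_
  case refine_13 =>
    intro i h1 h2
    fin_cases i <;> simp [ofRanks, Fin.sum_univ_four] at h1 h2 ⊢ <;>
      first | done | (refine ⟨?_, ?_⟩ <;> ring)
  all_goals simp [ofRanks, Fin.sum_univ_four]
  all_goals first | done | linarith

end Moves

end Exchange

end FlipIET

/-! ### Rounds of induction and minimality of admissible exchanges -/

namespace FlipIET

namespace Exchange

/-- The lengths before a round of left induction in which the interval `3` wins against all others,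
and loses `c` times against the interval `2`. -/
noncomputable def roundA (c : ℕ) (x : Fin 4 → ℝ) : Fin 4 → ℝ :=
  ![x 0, x 1, x 2 + c * (x 3 + x 2), x 3 + x 2 + x 1 + x 0]

/-- The lengths before a round of left induction in which the interval `0` wins against all others,
and loses `c` times against the interval `1`. -/
noncomputable def roundB (c : ℕ) (x : Fin 4 → ℝ) : Fin 4 → ℝ :=
  ![x 0 + x 1 + x 2 + x 3, x 1 + c * (x 0 + x 1), x 2, x 3]

theorem roundA_pos (c : ℕ) {x : Fin 4 → ℝ} (hx : ∀ i, 0 < x i) (i : Fin 4) : 0 < roundA c x i := by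
  have h0 := hx 0
  have h1 := hx 1
  have h2 := hx 2
  have h3 := hx 3
  fin_cases i <;> simp [roundA] <;> positivity

theorem roundB_pos (c : ℕ) {x : Fin 4 → ℝ} (hx : ∀ i, 0 < x i) (i : Fin 4) : 0 < roundB c x i := by
  have h0 := hx 0
  have h1 := hx 1
  have h2 := hx 2
  have h3 := hx 3
  fin_cases i <;> simp [roundB] <;> positivity

theorem eq_vec_four (x : Fin 4 → ℝ) : x = ![x 0, x 1, x 2, x 3] := by
  ext i
  fin_cases i <;> rfl

section Rounds

variable {x x' : Fin 4 → ℝ}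

theorem induced_roundA₁ (c : ℕ) (hx : ∀ i, 0 < x i) :
    Induced (reversal (roundA c x)) (ofRanks ![2, 0, 1, 3] ![3, 2, 1, 0]
      ![x 0, x 1, x 2 + c * (x 3 + x 2), x 3 + x 2 + x 1]) 0 3 0 :=
  induced_a₁ (reversal_valid (roundA_pos c hx)) (by linarith [hx 1, hx 2, hx 3])

theorem induced_roundA₂ (c : ℕ) (hx : ∀ i, 0 < x i) :
    Induced (ofRanks ![2, 0, 1, 3] ![3, 2, 1, 0]
      ![x 0, x 1, x 2 + c * (x 3 + x 2), x 3 + x 2 + x 1]) (ofRanks ![1, 2, 0, 3] ![3, 2, 1, 0]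
      ![x 0, x 1, x 2 + c * (x 3 + x 2), x 3 + x 2]) 1 3 1 :=
  induced_a₂ (induced_roundA₁ c hx).valid₁ (by linarith [hx 2, hx 3])

theorem induced_roundA₃ (c : ℕ) (hx : ∀ i, 0 < x i) :
    Induced (ofRanks ![1, 2, 0, 3] ![3, 2, 1, 0]
      ![x 0, x 1, x 2 + (c + 1 : ℕ) * (x 3 + x 2), x 3 + x 2])
      (ofRanks ![1, 2, 0, 3] ![3, 2, 1, 0]
      ![x 0, x 1, x 2 + c * (x 3 + x 2), x 3 + x 2]) 3 3 2 := by
  have h := (induced_roundA₂ (c + 1) hx).valid₁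
  have e : x 2 + (c + 1 : ℕ) * (x 3 + x 2) = x 2 + c * (x 3 + x 2) + (x 3 + x 2) := by
    push_cast
    ring
  rw [e] at h ⊢
  have h2 := hx 2
  have h3 := hx 3
  exact induced_a₃ h (by positivity)

theorem induced_roundA₄ (hx : ∀ i, 0 < x i) :
    Induced (ofRanks ![1, 2, 0, 3] ![3, 2, 1, 0]
      ![x 0, x 1, x 2 + (0 : ℕ) * (x 3 + x 2), x 3 + x 2]) (reversal x) 2 3 2 := by
  have h := (induced_roundA₂ 0 hx).valid₁
  rw [Nat.cast_zero, zero_mul, add_zero] at h ⊢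
  have := induced_a₄ h (hx 3)
  rwa [← eq_vec_four] at this

theorem induced_roundB₁ (c : ℕ) (hx : ∀ i, 0 < x i) :
    Induced (reversal (roundB c x)) (ofRanks ![0, 1, 2, 3] ![3, 1, 0, 2]
      ![x 0 + x 1 + x 2, x 1 + c * (x 0 + x 1), x 2, x 3]) 3 3 0 :=
  induced_b₁ (reversal_valid (roundB_pos c hx)) (by linarith [hx 0, hx 1, hx 2])

theorem induced_roundB₂ (c : ℕ) (hx : ∀ i, 0 < x i) :
    Induced (ofRanks ![0, 1, 2, 3] ![3, 1, 0, 2]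
      ![x 0 + x 1 + x 2, x 1 + c * (x 0 + x 1), x 2, x 3]) (ofRanks ![0, 1, 2, 3] ![3, 0, 2, 1]
      ![x 0 + x 1, x 1 + c * (x 0 + x 1), x 2, x 3]) 2 2 0 :=
  induced_b₂ (induced_roundB₁ c hx).valid₁ (by linarith [hx 0, hx 1])

theorem induced_roundB₃ (c : ℕ) (hx : ∀ i, 0 < x i) :
    Induced (ofRanks ![0, 1, 2, 3] ![3, 0, 2, 1]
      ![x 0 + x 1, x 1 + (c + 1 : ℕ) * (x 0 + x 1), x 2, x 3])
      (ofRanks ![0, 1, 2, 3] ![3, 0, 2, 1]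
      ![x 0 + x 1, x 1 + c * (x 0 + x 1), x 2, x 3]) 0 1 0 := by
  have h := (induced_roundB₂ (c + 1) hx).valid₁
  have e : x 1 + (c + 1 : ℕ) * (x 0 + x 1) = x 1 + c * (x 0 + x 1) + (x 0 + x 1) := by
    push_cast
    ring
  rw [e] at h ⊢
  have h0 := hx 0
  have h1 := hx 1
  exact induced_b₃ h (by positivity)

theorem induced_roundB₄ (hx : ∀ i, 0 < x i) :
    Induced (ofRanks ![0, 1, 2, 3] ![3, 0, 2, 1]
      ![x 0 + x 1, x 1 + (0 : ℕ) * (x 0 + x 1), x 2, x 3]) (reversal x) 1 1 0 := by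
  have h := (induced_roundB₂ 0 hx).valid₁
  rw [Nat.cast_zero, zero_mul, add_zero] at h ⊢
  have := induced_b₄ h (hx 0)
  rwa [← eq_vec_four] at this

theorem pairPath_roundA (c : ℕ) (hx : ∀ i, 0 < x i) (hx' : ∀ i, 0 < x' i) :
    PairPath (reversal (roundA c x), reversal (roundA c x')) (reversal x, reversal x') := by
  have loop : PairPath (ofRanks ![1, 2, 0, 3] ![3, 2, 1, 0]
      ![x 0, x 1, x 2 + c * (x 3 + x 2), x 3 + x 2], ofRanks ![1, 2, 0, 3] ![3, 2, 1, 0]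
      ![x' 0, x' 1, x' 2 + c * (x' 3 + x' 2), x' 3 + x' 2]) (reversal x, reversal x') := by
    induction c with
    | zero => exact .single (.intro (induced_roundA₄ hx) (induced_roundA₄ hx'))
    | succ c ih => exact .head (.intro (induced_roundA₃ c hx) (induced_roundA₃ c hx')) ih
  exact .head (.intro (induced_roundA₁ c hx) (induced_roundA₁ c hx'))
    (.head (.intro (induced_roundA₂ c hx) (induced_roundA₂ c hx')) loop)

theorem pairPath_roundB (c : ℕ) (hx : ∀ i, 0 < x i) (hx' : ∀ i, 0 < x' i) :
    PairPath (reversal (roundB c x), reversal (roundB c x')) (reversal x, reversal x') := by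
  have loop : PairPath (ofRanks ![0, 1, 2, 3] ![3, 0, 2, 1]
      ![x 0 + x 1, x 1 + c * (x 0 + x 1), x 2, x 3], ofRanks ![0, 1, 2, 3] ![3, 0, 2, 1]
      ![x' 0 + x' 1, x' 1 + c * (x' 0 + x' 1), x' 2, x' 3]) (reversal x, reversal x') := by
    induction c with
    | zero => exact .single (.intro (induced_roundB₄ hx) (induced_roundB₄ hx'))
    | succ c ih => exact .head (.intro (induced_roundB₃ c hx) (induced_roundB₃ c hx')) ih
  exact .head (.intro (induced_roundB₁ c hx) (induced_roundB₁ c hx'))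
    (.head (.intro (induced_roundB₂ c hx) (induced_roundB₂ c hx')) loop)

theorem visits_roundA_loop (c : ℕ) (hx : ∀ i, 0 < x i) {S : Set (Fin 4)}
    (hS : (ofRanks ![1, 2, 0, 3] ![3, 2, 1, 0]
      ![x 0, x 1, x 2 + (0 : ℕ) * (x 3 + x 2), x 3 + x 2]).Visits S) :
    (ofRanks ![1, 2, 0, 3] ![3, 2, 1, 0]
      ![x 0, x 1, x 2 + c * (x 3 + x 2), x 3 + x 2]).Visits S := by
  induction c with
  | zero => exact hS
  | succ c ih => exact (induced_roundA₃ c hx).visits_same ih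

theorem visits_roundB_loop (c : ℕ) (hx : ∀ i, 0 < x i) {S : Set (Fin 4)}
    (hS : (ofRanks ![0, 1, 2, 3] ![3, 0, 2, 1]
      ![x 0 + x 1, x 1 + (0 : ℕ) * (x 0 + x 1), x 2, x 3]).Visits S) :
    (ofRanks ![0, 1, 2, 3] ![3, 0, 2, 1]
      ![x 0 + x 1, x 1 + c * (x 0 + x 1), x 2, x 3]).Visits S := by
  induction c with
  | zero => exact hS
  | succ c ih => exact (induced_roundB₃ c hx).visits_same ih

/-- Going back through the round, the letters 2, 1, 0 lose against 3 in turn and each is exchanged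
for 3, while the loop in between changes nothing. -/
theorem visits_roundA_winner (c : ℕ) (hx : ∀ i, 0 < x i) : (reversal (roundA c x)).Visits {3} := by
  have h₄ := (induced_roundA₄ hx).visits (S' := {i | i ≠ 2}) (k := 3)
    (reversal_valid hx).visits_univ (Or.inl rfl) (by simp) (by simp)
  have h₂ := (induced_roundA₂ c hx).visits (S' := {i | i ≠ 2 ∧ i ≠ 1}) (k := 3)
    (visits_roundA_loop c hx h₄) (Or.inl rfl) (fun i hi hi' => ⟨hi, hi'⟩) (by simp)
  exact (induced_roundA₁ c hx).visits (k := 3) h₂ (Or.inl rfl)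
    (by simp only [Set.mem_ofPred_eq, Set.mem_singleton_iff]; decide) (by simp)

theorem visits_roundB_winner (c : ℕ) (hx : ∀ i, 0 < x i) : (reversal (roundB c x)).Visits {0} := by
  have h₄ := (induced_roundB₄ hx).visits (S' := {i | i ≠ 1}) (k := 0)
    (reversal_valid hx).visits_univ (Or.inr rfl) (by simp) (by simp)
  have h₂ := (induced_roundB₂ c hx).visits (S' := {i | i ≠ 1 ∧ i ≠ 2}) (k := 0)
    (visits_roundB_loop c hx h₄) (Or.inr rfl) (fun i hi hi' => ⟨hi, hi'⟩) (by simp)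
  exact (induced_roundB₁ c hx).visits (k := 0) h₂ (Or.inr rfl)
    (by simp only [Set.mem_ofPred_eq, Set.mem_singleton_iff]; decide) (by simp)

/-- If the loop is run at least once, 3 loses against 2 and may be exchanged for it. -/
theorem visits_roundA_two {c : ℕ} (hc : c ≠ 0) (hx : ∀ i, 0 < x i)
    (h : (reversal x).Visits {3}) : (reversal (roundA c x)).Visits {2} := by
  obtain ⟨c, rfl⟩ := Nat.exists_eq_succ_of_ne_zero hc
  have h₃ := (induced_roundA₃ c hx).visits (S' := {2}) (k := 2)
    (visits_roundA_loop c hx ((induced_roundA₄ hx).visits_same h)) (Or.inr rfl) (by simp) (by simp)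
  exact (induced_roundA₁ _ hx).visits_same ((induced_roundA₂ _ hx).visits_same h₃)

theorem visits_roundB_one {c : ℕ} (hc : c ≠ 0) (hx : ∀ i, 0 < x i)
    (h : (reversal x).Visits {0}) : (reversal (roundB c x)).Visits {1} := by
  obtain ⟨c, rfl⟩ := Nat.exists_eq_succ_of_ne_zero hc
  have h₃ := (induced_roundB₃ c hx).visits (S' := {1}) (k := 1)
    (visits_roundB_loop c hx ((induced_roundB₄ hx).visits_same h)) (Or.inl rfl) (by simp) (by simp)
  exact (induced_roundB₁ _ hx).visits_same ((induced_roundB₂ _ hx).visits_same h₃)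

end Rounds

/-- The parameter of the first half of the `k`-th round. -/
def paramA (k : ℕ) : ℕ := 7 * 15 ^ k

/-- The parameter of the second half of the `k`-th round. -/
def paramB (k : ℕ) : ℕ := 28 * 15 ^ k

/-- The lengths before the `k`-th round. -/
noncomputable def fullRound (k : ℕ) (x : Fin 4 → ℝ) : Fin 4 → ℝ :=
  roundA (paramA k) (roundB (paramB k) x)

theorem fullRound_pos (k : ℕ) {x : Fin 4 → ℝ} (hx : ∀ i, 0 < x i) (i : Fin 4) :
    0 < fullRound k x i :=
  roundA_pos _ (roundB_pos _ hx) i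

theorem pairPath_fullRound (k : ℕ) {x x' : Fin 4 → ℝ} (hx : ∀ i, 0 < x i) (hx' : ∀ i, 0 < x' i) :
    PairPath (reversal (fullRound k x), reversal (fullRound k x')) (reversal x, reversal x') :=
  (pairPath_roundA _ (roundB_pos _ hx) (roundB_pos _ hx')).trans (pairPath_roundB _ hx hx')

/-- Two rounds are needed: the winners 3 and 0 of the later round are visited by all orbits, and the
loops of the earlier round pass this on from 0 to 1 and from 3 to 2. -/
theorem visits_fullRound (k : ℕ) {x : Fin 4 → ℝ} (hx : ∀ i, 0 < x i) (i : Fin 4) :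
    (reversal (fullRound k (fullRound (k + 1) x))).Visits {i} := by
  set y := fullRound (k + 1) x
  have hy : ∀ i, 0 < y i := fullRound_pos _ hx
  have hA : ∀ {S}, (reversal (roundB (paramB k) y)).Visits S →
      (reversal (fullRound k y)).Visits S := fun h =>
    (pairPath_roundA (paramA k) (roundB_pos _ hy) (roundB_pos (paramB k) hy)).visits h
  have hB : ∀ {S}, (reversal y).Visits S → (reversal (roundB (paramB k) y)).Visits S := fun h =>
    (pairPath_roundB (paramB k) hy hy).visits h
  have h3 : (reversal y).Visits {3} := visits_roundA_winner _ (roundB_pos _ hx)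
  have h0 : (reversal y).Visits {0} :=
    (pairPath_roundA _ (roundB_pos _ hx) (roundB_pos (paramB (k + 1)) hx)).visits (visits_roundB_winner _ hx)
  fin_cases i
  · exact hA (hB h0)
  · exact hA (visits_roundB_one (by simp [paramB]) hy h0)
  · exact visits_roundA_two (by simp [paramA]) (roundB_pos _ hy) (hB h3)
  · exact hA (hB h3)

/-- Hence the domains shrink at least by half in every round, whatever the parameters. -/
theorem sum_fullRound (k : ℕ) {x : Fin 4 → ℝ} (hx : ∀ i, 0 ≤ x i) :
    2 * ∑ i, x i ≤ ∑ i, fullRound k x i := by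
  have h0 := hx 0
  have h1 := hx 1
  have h2 := hx 2
  have h3 := hx 3
  simp only [Fin.sum_univ_four, fullRound, roundA, roundB, Matrix.cons_val]
  have : 0 ≤ (paramB k : ℝ) * (x 0 + x 1) := by positivity
  have : 0 ≤ (paramA k : ℝ) * (x 3 + x 2) := by positivity
  linarith

/-- The lengths of transformations that can be induced infinitely often, with the prescribed
rounds. -/
structure Admissible (L : ℕ → Fin 4 → ℝ) : Prop where
  pos : ∀ k i, 0 < L k i
  round : ∀ k, L k = fullRound k (L (k + 1))
  sum_eq : ∑ i, L 0 i = 1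

open Filter Topology

namespace Admissible

variable {L L' : ℕ → Fin 4 → ℝ}

theorem valid (h : Admissible L) (k : ℕ) : (reversal (L k)).Valid := reversal_valid (h.pos k)

theorem tendsto (h : Admissible L) :
    Tendsto (fun k => (reversal (L k)).hi - (reversal (L k)).lo) atTop (𝓝 0) := by
  have h1 : ∀ k, (reversal (L k)).hi - (reversal (L k)).lo = ∑ i, L k i := by
    intro k
    simp [ofRanks]
  simp only [h1]
  refine squeeze_zero (g := fun k => (1 / 2 : ℝ) ^ k)
    (fun k => Finset.sum_nonneg fun i _ => (h.pos k i).le) (fun k => ?_)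
    (tendsto_pow_atTop_nhds_zero_of_lt_one (by norm_num) (by norm_num))
  induction k with
  | zero => simp [h.sum_eq]
  | succ k ih =>
    have := sum_fullRound k fun i => (h.pos (k + 1) i).le
    rw [← h.round k] at this
    rw [pow_succ]
    linarith

theorem pairPath (h : Admissible L) (h' : Admissible L') (k : ℕ) :
    PairPath (reversal (L k), reversal (L' k)) (reversal (L (k + 1)), reversal (L' (k + 1))) := by
  rw [h.round k, h'.round k]
  exact pairPath_fullRound k (h.pos _) (h'.pos _)

theorem visits (h : Admissible L) (k : ℕ) (i : Fin 4) : (reversal (L k)).Visits {i} := by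
  rw [h.round k, h.round (k + 1)]
  exact visits_fullRound k (h.pos _) i

/-- At a deep level whole pieces are small enough and all orbits visit them; this is carried back to
level 0. -/
theorem fine (h : Admissible L) {ε : ℝ} (hε : 0 < ε) : (reversal (L 0)).Fine ε := by
  obtain ⟨N, hN⟩ := (h.tendsto.eventually_lt_const hε).exists
  have h1 := (h.valid N).fine (h.visits N)
  have h2 : ∀ N, (reversal (L N)).Fine ((reversal (L N)).hi - (reversal (L N)).lo) →
      (reversal (L 0)).Fine ((reversal (L N)).hi - (reversal (L N)).lo) := by
    intro N
    -- The scale has to stay fixed while the level descends.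
    generalize (reversal (L N)).hi - (reversal (L N)).lo = δ
    induction N with
    | zero => exact _root_.id
    | succ N ih => exact fun hN => ih ((h.pairPath h N).fine hN)
  intro x hx
  obtain ⟨F, h3, h4, h5⟩ := h2 N h1 x hx
  exact ⟨F, h3, fun y hy => (h4 y hy).trans hN.le, h5⟩

theorem dom_eq (h : Admissible L) : (reversal (L 0)).dom = Set.Ico 0 1 := by
  simp [dom, ofRanks, h.sum_eq]

/-- All orbits come close to all points within a bounded time. -/
theorem exists_iterate (h : Admissible L) {ε : ℝ} (hε : 0 < ε) {x : ℝ} (hx : x ∈ Set.Ico (0 : ℝ) 1) :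
    ∃ N, ∀ y ∈ Set.Ico (0 : ℝ) 1, ∃ t ≤ N, |(reversal (L 0)).map^[t] y - x| ≤ ε := by
  rw [← h.dom_eq] at hx ⊢
  obtain ⟨F, -, hF, -, N, hN⟩ := h.fine hε x hx
  refine ⟨N, fun y hy => ?_⟩
  obtain ⟨t, ht, hy⟩ := hN y hy
  exact ⟨t, ht, hF _ hy⟩

open MeasureTheory in
theorem exists_invariant (h : Admissible L) (h' : Admissible L') :
    ∃ μ : Measure ℝ, μ Set.univ = 1 ∧ μ (Set.Ico (0 : ℝ) 1)ᶜ = 0 ∧ (∀ c, μ {c} = 0) ∧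
      (∀ A, MeasurableSet A → μ ((reversal (L 0)).map ⁻¹' A) = μ A) ∧
      ∀ i, μ ((reversal (L 0)).piece i) = ENNReal.ofReal (L' 0 i) := by
  -- The source is the transformation for `L'`, whose Lebesgue measure is pushed forward to the one
  -- for `L`.
  obtain ⟨φ, h1, h2, h3, h4⟩ := exists_semiconj
    (fun k => (reversal (L' k), reversal (L k))) h'.valid h.valid (h'.pairPath h) h'.tendsto
    h.tendsto
  obtain ⟨μ, g1, g2, g3⟩ := exists_invariant_of_semiconj (h'.valid 0) (h.valid 0) h1 h2 h3 h4
  refine ⟨μ, ?_, ?_, g3⟩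
  · rw [g1]
    simp [ofRanks, h'.sum_eq]
  · rwa [h.dom_eq] at g2

end Admissible

end Exchange

end FlipIET

/-! ### Invariant cones and the failure of unique ergodicity -/

namespace FlipIET

namespace Exchange

theorem fullRound_apply (k : ℕ) (x : Fin 4 → ℝ) :
    fullRound k x 0 = x 0 + x 1 + x 2 + x 3 ∧
    fullRound k x 1 = x 1 + paramB k * (x 0 + x 1) ∧
    fullRound k x 2 = x 2 + paramA k * (x 3 + x 2) ∧
    fullRound k x 3 = x 3 + x 2 + (x 1 + paramB k * (x 0 + x 1)) + (x 0 + x 1 + x 2 + x 3) := by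
  simp [fullRound, roundA, roundB]

theorem fullRound_smul_add (k : ℕ) (s t : ℝ) (x y : Fin 4 → ℝ) :
    fullRound k (s • x + t • y) = s • fullRound k x + t • fullRound k y := by
  ext i
  fin_cases i <;> simp [fullRound, roundA, roundB] <;> ring

theorem fullRound_smul (k : ℕ) (s : ℝ) (x : Fin 4 → ℝ) :
    fullRound k (s • x) = s • fullRound k x := by
  simpa using fullRound_smul_add k s 0 x 0

theorem continuous_fullRound (k : ℕ) : Continuous (fullRound k) := by
  refine continuous_pi fun i => ?_
  fin_cases i <;> simp [fullRound, roundA, roundB] <;> fun_prop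

theorem fullRound_nonneg (k : ℕ) {x : Fin 4 → ℝ} (hx : ∀ i, 0 ≤ x i) (i : Fin 4) :
    0 ≤ fullRound k x i := by
  have h0 := hx 0
  have h1 := hx 1
  have h2 := hx 2
  have h3 := hx 3
  fin_cases i <;> simp [fullRound, roundA, roundB] <;> positivity

/-- The composition of the `n` rounds from the `k`-th one on. -/
noncomputable def rounds : ℕ → ℕ → (Fin 4 → ℝ) → Fin 4 → ℝ
  | _, 0, x => x
  | k, n + 1, x => fullRound k (rounds (k + 1) n x)

theorem rounds_nonneg (k n : ℕ) {x : Fin 4 → ℝ} (hx : ∀ i, 0 ≤ x i) (i : Fin 4) :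
    0 ≤ rounds k n x i := by
  induction n generalizing k i with
  | zero => exact hx i
  | succ n ih => exact fullRound_nonneg k (fun j => ih (k + 1) j) i

theorem rounds_mem {C : ℕ → Set (Fin 4 → ℝ)} (hmap : ∀ k, ∀ x ∈ C (k + 1), fullRound k x ∈ C k)
    (k n : ℕ) {x : Fin 4 → ℝ} (hx : x ∈ C (k + n)) : rounds k n x ∈ C k := by
  induction n generalizing k with
  | zero => exact hx
  | succ n ih =>
    refine hmap k _ (ih (k + 1) ?_)
    rwa [show k + 1 + n = k + (n + 1) by ring]

/-- Totals can only grow when rounds are added in front, so dividing by the total at level 0 bounds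
all levels by 1. -/
theorem sum_rounds_le (j k n : ℕ) {x : Fin 4 → ℝ} (hx : ∀ i, 0 ≤ x i) :
    ∑ i, rounds (k + j) n x i ≤ ∑ i, rounds k (n + j) x i := by
  induction j generalizing k with
  | zero => exact le_rfl
  | succ j ih =>
    have h1 := ih (k + 1)
    rw [show k + 1 + j = k + (j + 1) by ring] at h1
    have h2 := sum_fullRound k (rounds_nonneg (k + 1) (n + j) hx)
    have h3 := Finset.sum_nonneg fun i (_ : i ∈ Finset.univ) =>
      rounds_nonneg (k + 1) (n + j) hx i
    have h4 : rounds k (n + (j + 1)) x = fullRound k (rounds (k + 1) (n + j) x) := rfl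
    rw [h4]
    linarith

/-- No level vanishes, since the rounds are linear and level 0 has sum 1. So the first length, the
total of the next level, is positive, and the positive parameters spread this to the lengths 1, 3
and 2. Closed cones therefore suffice for finding admissible sequences. -/
theorem Admissible.of_nonneg {L : ℕ → Fin 4 → ℝ} (hL : ∀ k i, 0 ≤ L k i)
    (hround : ∀ k, L k = fullRound k (L (k + 1))) (hsum : ∑ i, L 0 i = 1) : Admissible L := by
  have hne : ∀ k, L k ≠ 0 := by
    intro k
    induction k with
    | zero =>
      intro h
      rw [h] at hsum
      simp at hsum
    | succ k ih =>
      intro h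
      apply ih
      rw [hround, h]
      simpa using fullRound_smul k 0 0
  have h0 : ∀ k, 0 < L k 0 := by
    intro k
    rw [hround k, (fullRound_apply k _).1, ← Fin.sum_univ_four]
    refine lt_of_le_of_ne (Finset.sum_nonneg fun i _ => hL _ i) fun h => hne (k + 1) ?_
    ext i
    exact (Finset.sum_eq_zero_iff_of_nonneg fun i _ => hL (k + 1) i).1 h.symm i (Finset.mem_univ i)
  have hb : ∀ k, 0 < (paramB k : ℝ) := fun k => by simp [paramB]
  have ha : ∀ k, 0 < (paramA k : ℝ) := fun k => by simp [paramA]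
  have h1 : ∀ k, 0 < L k 1 := by
    intro k
    rw [hround k, (fullRound_apply k _).2.1]
    have := hL (k + 1) 1
    have := h0 (k + 1)
    have := hb k
    positivity
  have h3 : ∀ k, 0 < L k 3 := by
    intro k
    rw [hround k, (fullRound_apply k _).2.2.2]
    have := hL (k + 1) 2
    have := hL (k + 1) 3
    have := h1 (k + 1)
    have := h0 (k + 1)
    have := hb k
    positivity
  have h2 : ∀ k, 0 < L k 2 := by
    intro k
    rw [hround k, (fullRound_apply k _).2.2.1]
    have := hL (k + 1) 2
    have := h3 (k + 1)
    have := ha k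
    positivity
  refine ⟨fun k i => ?_, hround, hsum⟩
  fin_cases i
  · exact h0 k
  · exact h1 k
  · exact h2 k
  · exact h3 k

/-- A sequence of cones that are compatible with the rounds contains an admissible sequence. -/
theorem exists_admissible_mem {C : ℕ → Set (Fin 4 → ℝ)} (hclosed : ∀ k, IsClosed (C k))
    (hnonneg : ∀ k, ∀ x ∈ C k, ∀ i, 0 ≤ x i)
    (hsmul : ∀ k, ∀ x ∈ C k, ∀ s : ℝ, 0 ≤ s → s • x ∈ C k)
    (hmap : ∀ k, ∀ x ∈ C (k + 1), fullRound k x ∈ C k)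
    (hne : ∀ k, ∃ x ∈ C k, 0 < ∑ i, x i) :
    ∃ L, Admissible L ∧ ∀ k, L k ∈ C k := by
  -- The conditions up to level N define nested compact sets in the product of unit cubes; a common
  -- point is the sequence sought.
  set K : ℕ → Set (ℕ → Fin 4 → ℝ) := fun N => Set.Icc 0 1 ∩ ({L | ∑ i, L 0 i = 1} ∩
    ({L | ∀ k ≤ N, L k ∈ C k} ∩ {L | ∀ k < N, L k = fullRound k (L (k + 1))}))
  have hKclosed : ∀ N, IsClosed (K N) := by
    intro N
    refine isClosed_Icc.inter ((isClosed_eq (by fun_prop) continuous_const).inter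
      (IsClosed.inter ?_ ?_))
    · simp only [Set.ofPred_forall]
      exact isClosed_iInter fun k => isClosed_iInter fun _ =>
        (hclosed k).preimage (continuous_apply k)
    · simp only [Set.ofPred_forall]
      exact isClosed_iInter fun k => isClosed_iInter fun _ =>
        isClosed_eq (continuous_apply k) ((continuous_fullRound k).comp (continuous_apply (k + 1)))
  have hKne : ∀ N, (K N).Nonempty := by
    intro N
    obtain ⟨x, hx, hpos⟩ := hne N
    have hx0 := hnonneg N x hx
    set s := ∑ i, rounds 0 N x i with hs
    have hle : ∀ k ≤ N, ∑ i, rounds k (N - k) x i ≤ s := by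
      intro k hk
      have := sum_rounds_le k 0 (N - k) hx0
      rwa [Nat.sub_add_cancel hk, zero_add] at this
    have hspos : 0 < s := by
      refine lt_of_lt_of_le hpos ?_
      have := hle N le_rfl
      rwa [Nat.sub_self] at this
    have hle1 : ∀ k ≤ N, ∀ i, rounds k (N - k) x i ≤ s := fun k hk i =>
      (Finset.single_le_sum (fun j _ => rounds_nonneg k (N - k) hx0 j)
        (Finset.mem_univ i)).trans (hle k hk)
    -- A cone vector of level N is pulled back through the rounds and normalised; the levels beyond
    -- N are not constrained by `K N`.
    refine ⟨fun k => if k ≤ N then s⁻¹ • rounds k (N - k) x else 0, ⟨?_, ?_⟩, ?_, ?_, ?_⟩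
    · intro k i
      by_cases hk : k ≤ N
      · simp only [hk, if_true, Pi.zero_apply, Pi.smul_apply, smul_eq_mul]
        exact mul_nonneg (inv_nonneg.2 hspos.le) (rounds_nonneg _ _ hx0 i)
      · simp [hk]
    · intro k i
      by_cases hk : k ≤ N
      · simp only [hk, if_true, Pi.one_apply, Pi.smul_apply, smul_eq_mul]
        rw [inv_mul_le_one₀ hspos]
        exact hle1 k hk i
      · simp [hk]
    · simp only [Set.mem_ofPred_eq, Nat.zero_le, if_true, Nat.sub_zero, Pi.smul_apply, smul_eq_mul]
      rw [← Finset.mul_sum, ← hs, inv_mul_cancel₀ hspos.ne']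
    · intro k hk
      simp only [hk, if_true]
      refine hsmul k _ (rounds_mem hmap k _ ?_) _ (inv_nonneg.2 hspos.le)
      rwa [Nat.add_sub_cancel' hk]
    · intro k hk
      have h1 : k + 1 ≤ N := hk
      simp only [hk.le, h1, if_true]
      rw [fullRound_smul, show N - k = (N - (k + 1)) + 1 by omega]
      rfl
  have hKanti : ∀ N, K (N + 1) ⊆ K N := by
    rintro N L ⟨h1, h2, h3, h4⟩
    exact ⟨h1, h2, fun k hk => h3 k (by omega), fun k hk => h4 k (by omega)⟩
  obtain ⟨L, hL⟩ := IsCompact.nonempty_iInter_of_sequence_nonempty_isCompact_isClosed K hKanti hKne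
    ((isCompact_Icc).of_isClosed_subset (hKclosed 0) Set.inter_subset_left) hKclosed
  rw [Set.mem_iInter] at hL
  refine ⟨L, Admissible.of_nonneg (fun k i => (hL 0).1.1 k i)
    (fun k => (hL (k + 1)).2.2.2 k (Nat.lt_succ_self k)) (hL 0).2.1, fun k => (hL k).2.2.1 k le_rfl⟩

theorem paramA_ge (k : ℕ) : (7 : ℝ) ≤ paramA k := by
  have : 1 ≤ 15 ^ k := Nat.one_le_pow _ _ (by norm_num)
  have h : 7 ≤ paramA k := by unfold paramA; omega
  exact_mod_cast h

theorem paramB_eq (k : ℕ) : (paramB k : ℝ) = 4 * paramA k := by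
  simp only [paramA, paramB]
  push_cast
  ring

theorem paramA_succ (k : ℕ) : (paramA (k + 1) : ℝ) = 15 * paramA k := by
  simp only [paramA]
  push_cast
  ring

/-- In the cone x₂ ≤ x₁, x₃ ≤ 3x₁ one has x₃ + x₂ ≤ 4x₁, so a second parameter equal to four times
the first keeps the length 1 dominant over the length 2. -/
theorem exists_admissible_ge : ∃ L, Admissible L ∧ 1 / 6 ≤ L 0 1 := by
  have hex : ∃ L, Admissible L ∧ ∀ k, L k ∈ (fun _ => {x | (∀ i, 0 ≤ x i) ∧ x 2 ≤ x 1 ∧ x 3 ≤ 3 * x 1} : ℕ → Set (Fin 4 → ℝ)) k := by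
    refine exists_admissible_mem ?_ ?_ ?_ ?_ ?_
    · intro k
      simp only [Set.ofPred_and, Set.ofPred_forall]
      refine IsClosed.inter (isClosed_iInter fun i => ?_) (IsClosed.inter ?_ ?_) <;>
        exact isClosed_le (by fun_prop) (by fun_prop)
    · exact fun k x hx => hx.1
    · rintro k x ⟨h0, h1, h2⟩ s hs
      refine ⟨fun i => mul_nonneg hs (h0 i), ?_, ?_⟩ <;> simp only [Pi.smul_apply, smul_eq_mul] <;>
        nlinarith
    · rintro k x ⟨h0, h1, h2⟩
      obtain ⟨-, e1, e2, e3⟩ := fullRound_apply k x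
      refine ⟨fullRound_nonneg k h0, ?_, ?_⟩
      all_goals
        rw [paramB_eq] at e1 e3
        have ha := paramA_ge k
        generalize (paramA k : ℝ) = a at *
        have p0 := mul_le_mul_of_nonneg_right ha (h0 0)
        have p1 := mul_le_mul_of_nonneg_right ha (h0 1)
        have p2 := mul_le_mul_of_nonneg_left h1 (show 0 ≤ a by linarith)
        have p3 := mul_le_mul_of_nonneg_left h2 (show 0 ≤ a by linarith)
        have q0 := h0 0
        have q1 := h0 1
        have q2 := h0 2
        have q3 := h0 3
      · rw [e1, e2]; linarith
      · rw [e1, e3]; linarith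
    · intro k
      refine ⟨![0, 1, 0, 0], ⟨fun i => ?_, ?_, ?_⟩, ?_⟩
      · fin_cases i <;> simp
      · simp
      · simp
      · simp [Fin.sum_univ_four]
  obtain ⟨L, hL, hC⟩ := hex
  refine ⟨L, hL, ?_⟩
  obtain ⟨h0, h1, h2⟩ := hC 0
  obtain ⟨g0, g1, g2⟩ := hC 1
  have e := hL.round 0
  obtain ⟨e0, e1, -⟩ := fullRound_apply 0 (L 1)
  rw [zero_add] at e
  rw [← e] at e0 e1
  have hs := hL.sum_eq
  rw [Fin.sum_univ_four] at hs
  have hB : (paramB 0 : ℝ) = 28 := by simp [paramB]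
  rw [hB] at e1
  -- The cone condition at level 1 gives L 0 0 ≤ L 0 1, so the total 1 is at most (1 + 1 + 1 + 3) L
  -- 0 1.
  linarith [g0 0, g0 1, g0 2, g0 3]

/-- Here the length 2 dominates by a factor of the order of the current parameter. Such cones are
compatible with the rounds because the parameters grow geometrically. At level 0 the condition 7x₁ ≤
x₂ ≤ 1 gives the bound. -/
theorem exists_admissible_le : ∃ L, Admissible L ∧ L 0 1 ≤ 1 / 7 := by
  have hex : ∃ L, Admissible L ∧ ∀ k, L k ∈ (fun k => {x | (∀ i, 0 ≤ x i) ∧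
      paramA k * x 1 ≤ x 2 ∧ paramA k * x 0 ≤ 2 * x 2 ∧ x 3 ≤ x 2} : ℕ → Set (Fin 4 → ℝ)) k := by
    refine exists_admissible_mem ?_ ?_ ?_ ?_ ?_
    · intro k
      simp only [Set.ofPred_and, Set.ofPred_forall]
      refine IsClosed.inter (isClosed_iInter fun i => ?_)
        (IsClosed.inter ?_ (IsClosed.inter ?_ ?_)) <;>
        exact isClosed_le (by fun_prop) (by fun_prop)
    · exact fun k x hx => hx.1
    · rintro k x ⟨h0, h1, h2, h3⟩ s hs
      refine ⟨fun i => mul_nonneg hs (h0 i), ?_, ?_, ?_⟩ <;> simp only [Pi.smul_apply, smul_eq_mul] <;>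
        nlinarith
    · rintro k x ⟨h0, h1, h2, h3⟩
      obtain ⟨e0, e1, e2, e3⟩ := fullRound_apply k x
      refine ⟨fullRound_nonneg k h0, ?_⟩
      rw [paramA_succ] at h1 h2
      rw [e0, e1, e2, e3]
      rw [paramB_eq]
      have ha := paramA_ge k
      generalize (paramA k : ℝ) = a at *
      have q0 := h0 0
      have q1 := h0 1
      have q2 := h0 2
      have q3 := h0 3
      have p0 := mul_le_mul_of_nonneg_right ha q0
      have p1 := mul_le_mul_of_nonneg_right ha q1
      have p2 := mul_le_mul_of_nonneg_right ha q2
      have p3 := mul_le_mul_of_nonneg_right ha q3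
      have ha0 : 0 ≤ a := by linarith
      refine ⟨?_, ?_, ?_⟩
      -- By the growth factor 15 the terms with `x 0` and `x 1` multiplied by 4a are at most 8/15
      -- and 4/15 of `x 2`, and the remaining `x 1` is at most 1/105 of it.
      · have h : x 1 + 4 * a * (x 0 + x 1) ≤ x 2 := by linarith
        have := mul_le_mul_of_nonneg_left h ha0
        have := mul_nonneg ha0 q3
        linarith
      · have h : x 0 + x 1 + x 2 + x 3 ≤ 2 * x 2 + x 3 := by linarith
        have := mul_le_mul_of_nonneg_left h ha0
        have := mul_nonneg ha0 q3
        linarith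
      · linarith
    · intro k
      refine ⟨![0, 0, 1, 0], ⟨fun i => ?_, ?_, ?_, ?_⟩, ?_⟩
      · fin_cases i <;> simp
      · simp
      · simp
      · simp
      · simp [Fin.sum_univ_four]
  obtain ⟨L, hL, hC⟩ := hex
  refine ⟨L, hL, ?_⟩
  obtain ⟨h0, h1, h2⟩ := hC 0
  have hs := hL.sum_eq
  rw [Fin.sum_univ_four] at hs
  have hA : (paramA 0 : ℝ) = 7 := by simp [paramA]
  rw [hA] at h1
  linarith [h0 0, h0 1, h0 2, h0 3]

theorem Admissible.convex {L L' : ℕ → Fin 4 → ℝ} (h : Admissible L) (h' : Admissible L') {s t : ℝ}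
    (hs : 0 ≤ s) (ht : 0 ≤ t) (hst : s + t = 1) : Admissible (s • L + t • L') := by
  refine Admissible.of_nonneg (fun k i => ?_) (fun k => ?_) ?_
  · exact add_nonneg (mul_nonneg hs (h.pos k i).le) (mul_nonneg ht (h'.pos k i).le)
  · change s • L k + t • L' k = fullRound k (s • L (k + 1) + t • L' (k + 1))
    rw [fullRound_smul_add, ← h.round, ← h'.round]
  · change ∑ i, (s * L 0 i + t * L' 0 i) = 1
    rw [Finset.sum_add_distrib, ← Finset.mul_sum, ← Finset.mul_sum, h.sum_eq, h'.sum_eq]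
    linarith

/-- There are two admissible sequences for each value of the length of the interval `1` in a
nontrivial interval, one with this value and one with another. -/
theorem exists_admissible_family : ∃ δ > 0, ∀ s ∈ Set.Ioo (1 / 7 : ℝ) (1 / 6),
    ∃ L L', Admissible L ∧ Admissible L' ∧ L 0 1 = s ∧ L' 0 1 ≠ s ∧ δ ≤ L 0 0 := by
  obtain ⟨L₁, h₁, hle⟩ := exists_admissible_le
  obtain ⟨L₂, h₂, hge⟩ := exists_admissible_ge
  refine ⟨min (L₁ 0 0) (L₂ 0 0), lt_min (h₁.pos 0 0) (h₂.pos 0 0), fun s hs => ?_⟩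
  have hd : 0 < L₂ 0 1 - L₁ 0 1 := by linarith [hs.1, hs.2]
  have h0 : 0 ≤ (L₂ 0 1 - s) / (L₂ 0 1 - L₁ 0 1) := div_nonneg (by linarith [hs.2]) hd.le
  have h1 : 0 ≤ (s - L₁ 0 1) / (L₂ 0 1 - L₁ 0 1) := div_nonneg (by linarith [hs.1]) hd.le
  have h01 : (L₂ 0 1 - s) / (L₂ 0 1 - L₁ 0 1) + (s - L₁ 0 1) / (L₂ 0 1 - L₁ 0 1) = 1 := by
    field_simp
    ring
  -- The weights are chosen so that the mixture has length `s` at 1. `L₁` differs from it there, as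
  -- its length 1 is at most 1/7, and a mixture of the first lengths is at least their minimum.
  refine ⟨_, L₁, h₁.convex h₂ h0 h1 h01, h₁, ?_, by linarith [hs.1], ?_⟩
  · change _ * L₁ 0 1 + _ * L₂ 0 1 = s
    field_simp
    ring
  · change _ ≤ _ * L₁ 0 0 + _ * L₂ 0 0
    have e1 := mul_le_mul_of_nonneg_left (min_le_left (L₁ 0 0) (L₂ 0 0)) h0
    have e2 := mul_le_mul_of_nonneg_left (min_le_right (L₁ 0 0) (L₂ 0 0)) h1
    have e3 : min (L₁ 0 0) (L₂ 0 0) = (L₂ 0 1 - s) / (L₂ 0 1 - L₁ 0 1) * min (L₁ 0 0) (L₂ 0 0) +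
        (s - L₁ 0 1) / (L₂ 0 1 - L₁ 0 1) * min (L₁ 0 0) (L₂ 0 0) := by
      rw [← add_mul, h01, one_mul]
    linarith

end Exchange

end FlipIET

/-! ### Transport of minimality and of invariant measures by an involution -/

namespace FlipIET

open MeasureTheory

variable {n : ℕ} {p : Param n} {T g : ℝ → ℝ} {Z : Set ℝ}

/-- Points z outside of the finite set Z are dense. For such z, g z is approximated by points g (u
k), and g, continuous at g z, sends them back to u k near z. -/
theorem Ico_subset_closure_range (hgg : Function.Involutive g)
    (hgI : ∀ x ∈ Set.Ico (0 : ℝ) 1, g x ∈ Set.Ico (0 : ℝ) 1) (hZ : Z.Finite)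
    (hgZ : ∀ x, x ∉ Z → g x ∉ Z) (hcont : ∀ x, x ∉ Z → ContinuousAt g x) {u : ℕ → ℝ}
    (hu : ∀ z ∈ Set.Ico (0 : ℝ) 1, ∀ ε > 0, ∃ k, |g (u k) - z| ≤ ε) :
    Set.Ico (0 : ℝ) 1 ⊆ closure (Set.range u) := by
  have hdense : Dense Zᶜ := hZ.countable.dense_compl ℝ
  have h1 : Set.Ico (0 : ℝ) 1 ⊆ closure (Set.Ioo 0 1) := by
    rw [closure_Ioo (by norm_num)]
    exact Set.Ico_subset_Icc_self
  refine h1.trans (closure_minimal ?_ isClosed_closure)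
  refine (hdense.open_subset_closure_inter isOpen_Ioo).trans
    (closure_minimal ?_ isClosed_closure)
  rintro z ⟨hz, hzZ⟩
  have hgz : g z ∈ closure (Set.range fun k => g (u k)) := by
    rw [Metric.mem_closure_iff]
    intro ε hε
    obtain ⟨k, hk⟩ := hu (g z) (hgI z (Set.Ioo_subset_Ico_self hz)) (ε / 2) (by positivity)
    refine ⟨_, ⟨k, rfl⟩, ?_⟩
    rw [dist_comm, Real.dist_eq]
    linarith
  have := mem_closure_image (hcont (g z) (hgZ z hzZ)) hgz
  rw [hgg z, ← Set.range_comp] at this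
  convert this using 3
  funext k
  exact (hgg (u k)).symm

/-- Forward orbits of f become T-orbits under g. For a backward orbit, `T` is run forward from the
N-th preimage; this is why the visiting time must be bounded uniformly in the starting point. -/
theorem isMinimal_of_conj (hstep : ∀ x y, Step p x y → x ∈ Set.Ico (0 : ℝ) 1 ∧ g y = T (g x))
    (hgg : Function.Involutive g)
    (hgI : ∀ x ∈ Set.Ico (0 : ℝ) 1, g x ∈ Set.Ico (0 : ℝ) 1) (hZ : Z.Finite)
    (hgZ : ∀ x, x ∉ Z → g x ∉ Z) (hcont : ∀ x, x ∉ Z → ContinuousAt g x)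
    (hT : ∀ z ∈ Set.Ico (0 : ℝ) 1, ∀ ε > 0, ∃ N, ∀ y ∈ Set.Ico (0 : ℝ) 1,
      ∃ t ≤ N, |T^[t] y - z| ≤ ε) :
    IsMinimal p := by
  rintro x hx (⟨u, rfl, hu⟩ | ⟨u, rfl, hu⟩)
  · have hit : ∀ t, T^[t] (g (u 0)) = g (u t) := by
      intro t
      induction t with
      | zero => rfl
      | succ t ih => rw [Function.iterate_succ_apply', ih, (hstep _ _ (hu t)).2]
    refine (Ico_subset_closure_range hgg hgI hZ hgZ hcont (u := u) fun z hz ε hε => ?_).trans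
      (closure_mono ?_)
    · obtain ⟨N, hN⟩ := hT z hz ε hε
      obtain ⟨t, -, ht⟩ := hN _ (hgI _ hx)
      exact ⟨t, by rwa [← hit]⟩
    · rintro _ ⟨k, rfl⟩
      left
      induction k with
      | zero => exact .refl
      | succ k ih => exact ih.tail (hu k)
  · have hit : ∀ t k, T^[t] (g (u (k + t))) = g (u k) := by
      intro t
      induction t with
      | zero => exact fun k => rfl
      | succ t ih =>
        intro k
        rw [Function.iterate_succ_apply, show k + (t + 1) = k + t + 1 by ring,
          ← (hstep _ _ (hu (k + t))).2, ih]
    refine (Ico_subset_closure_range hgg hgI hZ hgZ hcont (u := u) fun z hz ε hε => ?_).trans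
      (closure_mono ?_)
    · obtain ⟨N, hN⟩ := hT z hz ε hε
      have hmem : u N ∈ Set.Ico (0 : ℝ) 1 := by
        rcases N with _ | N
        · exact hx
        · exact (hstep _ _ (hu N)).1
      obtain ⟨t, htN, ht⟩ := hN _ (hgI _ hmem)
      refine ⟨N - t, ?_⟩
      rw [← hit t, Nat.sub_add_cancel htN]
      exact ht
    · rintro _ ⟨k, rfl⟩
      right
      induction k with
      | zero => exact .refl
      | succ k ih => exact ih.head (hu k)

/-- Since μ has no atoms and g is injective, the finite set where f may be undefined is null for the
image measure; elsewhere f is g ∘ T ∘ g. -/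
theorem isInvariantProb_of_conj
    (hstep : ∀ x y, Step p x y → x ∈ Set.Ico (0 : ℝ) 1 ∧ g y = T (g x))
    (hgg : Function.Involutive g) (hgm : Measurable g) (hTm : Measurable T)
    (hgI : ∀ x ∈ Set.Ico (0 : ℝ) 1, g x ∈ Set.Ico (0 : ℝ) 1) (hZ : Z.Finite)
    (hcover : ∀ x ∈ Set.Ico (0 : ℝ) 1, x ∉ Z → ∃ y, Step p x y)
    {μ : Measure ℝ} (h1 : μ Set.univ = 1) (hI : μ (Set.Ico (0 : ℝ) 1)ᶜ = 0)
    (hatom : ∀ c, μ {c} = 0) (hinv : ∀ A, MeasurableSet A → μ (T ⁻¹' A) = μ A) :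
    IsInvariantProb p (μ.map g) := by
  have hI' : (μ.map g) (Set.Ico (0 : ℝ) 1)ᶜ = 0 := by
    rw [Measure.map_apply hgm measurableSet_Ico.compl]
    refine measure_mono_null (fun x hx => ?_) hI
    exact fun hx' => hx (hgI x hx')
  have hZ' : (μ.map g) Z = 0 := by
    rw [← Set.biUnion_of_singleton Z, measure_biUnion_null_iff hZ.countable]
    intro c _
    rw [Measure.map_apply hgm (measurableSet_singleton c)]
    refine measure_mono_null (fun x hx => ?_) (hatom (g c))
    rw [Set.mem_preimage, Set.mem_singleton_iff] at hx
    rw [Set.mem_singleton_iff, ← hx, hgg]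
  refine ⟨⟨?_⟩, hI', fun A hA => ?_⟩
  · rw [Measure.map_apply hgm MeasurableSet.univ, Set.preimage_univ, h1]
  · have hB : MeasurableSet ((fun x => g (T (g x))) ⁻¹' A) := (hgm.comp (hTm.comp hgm)) hA
    have : (μ.map g) {x | ∃ y ∈ A, Step p x y} = (μ.map g) ((fun x => g (T (g x))) ⁻¹' A) := by
      refine measure_congr ?_
      have e1 : ∀ᵐ x ∂(μ.map g), x ∈ Set.Ico (0 : ℝ) 1 := by
        rw [ae_iff]
        exact hI'
      have e2 : ∀ᵐ x ∂(μ.map g), x ∉ Z := by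
        rw [ae_iff]
        simpa using hZ'
      filter_upwards [e1, e2] with x hx hxZ
      refine propext ⟨?_, fun h => ?_⟩
      · rintro ⟨y, hy, hxy⟩
        change g (T (g x)) ∈ A
        rwa [← (hstep x y hxy).2, hgg]
      · obtain ⟨y, hxy⟩ := hcover x hx hxZ
        refine ⟨y, ?_, hxy⟩
        have h' : g (T (g x)) ∈ A := h
        rwa [← (hstep x y hxy).2, hgg] at h'
    rw [this, Measure.map_apply hgm hB, Measure.map_apply hgm hA, ← hinv _ (hgm hA)]
    congr 1
    ext x
    simp only [Set.mem_preimage, hgg x]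

end FlipIET

/-! ### The reversing map and endpoints of ordered intervals -/

namespace FlipIET

section FlipMap

variable {c : ℕ → ℝ} {j : ℕ}

/-- The endpoints of consecutive intervals of lengths `c i`, starting at `0`. -/
noncomputable def cum (c : ℕ → ℝ) (k : ℕ) : ℝ := ∑ i ∈ Finset.range k, c i

theorem cum_zero (c : ℕ → ℝ) : cum c 0 = 0 := Finset.sum_range_zero c

theorem cum_succ (c : ℕ → ℝ) (k : ℕ) : cum c (k + 1) = cum c k + c k := Finset.sum_range_succ c k

theorem cum_mono (hc : ∀ i, 0 < c i) : Monotone (cum c) :=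
  monotone_nat_of_le_succ fun k => by rw [cum_succ]; linarith [hc k]

theorem cum_nonneg (hc : ∀ i, 0 < c i) (k : ℕ) : 0 ≤ cum c k :=
  Finset.sum_nonneg fun i _ => (hc i).le

/-- The map that reverses each of the first `j` of the consecutive intervals of lengths `c i`. -/
noncomputable def flipMap (c : ℕ → ℝ) (j : ℕ) (y : ℝ) : ℝ :=
  y + ∑ i ∈ Finset.range j, (Set.Ioo (cum c i) (cum c (i + 1))).indicator
    (fun y => cum c i + cum c (i + 1) - 2 * y) y

theorem measurable_flipMap (c : ℕ → ℝ) (j : ℕ) : Measurable (flipMap c j) :=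
  measurable_id.add (Finset.measurable_sum _ fun _ _ =>
    (measurable_const.sub (measurable_id.const_mul 2)).indicator measurableSet_Ioo)

theorem cum_interval_unique (hc : ∀ i, 0 < c i) {i i' : ℕ} {y : ℝ}
    (h : y ∈ Set.Ioo (cum c i) (cum c (i + 1))) (h' : y ∈ Set.Ioo (cum c i') (cum c (i' + 1))) :
    i = i' := by
  rcases lt_trichotomy i i' with hlt | heq | hgt
  · have := cum_mono hc (show i + 1 ≤ i' from hlt)
    linarith [h.2, h'.1]
  · exact heq
  · have := cum_mono hc (show i' + 1 ≤ i from hgt)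
    linarith [h.1, h'.2]

theorem flipMap_of_mem (hc : ∀ i, 0 < c i) {i : ℕ} (hi : i < j) {y : ℝ}
    (h : y ∈ Set.Ioo (cum c i) (cum c (i + 1))) :
    flipMap c j y = cum c i + cum c (i + 1) - y := by
  rw [flipMap, Finset.sum_eq_single i, Set.indicator_of_mem h]
  · ring
  · intro i' _ hne
    exact Set.indicator_of_notMem (fun h' => hne (cum_interval_unique hc h' h)) _
  · intro hi'
    exact absurd (Finset.mem_range.2 hi) hi'

theorem flipMap_of_notMem {y : ℝ} (h : ∀ i < j, y ∉ Set.Ioo (cum c i) (cum c (i + 1))) :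
    flipMap c j y = y := by
  rw [flipMap, Finset.sum_eq_zero, add_zero]
  intro i hi
  exact Set.indicator_of_notMem (h i (Finset.mem_range.1 hi)) _

theorem flipMap_of_ge (hc : ∀ i, 0 < c i) {y : ℝ} (h : cum c j ≤ y) : flipMap c j y = y := by
  refine flipMap_of_notMem fun i hi h' => ?_
  have := cum_mono hc (show i + 1 ≤ j from hi)
  linarith [h'.2]

theorem reflect_mem_Ioo {a b y : ℝ} (h : y ∈ Set.Ioo a b) : a + b - y ∈ Set.Ioo a b :=
  ⟨by linarith [h.2], by linarith [h.1]⟩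

theorem involutive_flipMap (hc : ∀ i, 0 < c i) : Function.Involutive (flipMap c j) := by
  intro y
  by_cases h : ∃ i < j, y ∈ Set.Ioo (cum c i) (cum c (i + 1))
  · obtain ⟨i, hi, h⟩ := h
    rw [flipMap_of_mem hc hi h, flipMap_of_mem hc hi (reflect_mem_Ioo h)]
    ring
  · push Not at h
    rw [flipMap_of_notMem h, flipMap_of_notMem h]

theorem flipMap_mem_Ico (hc : ∀ i, 0 < c i) (h1 : cum c j ≤ 1) {y : ℝ}
    (hy : y ∈ Set.Ico (0 : ℝ) 1) : flipMap c j y ∈ Set.Ico (0 : ℝ) 1 := by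
  by_cases h : ∃ i < j, y ∈ Set.Ioo (cum c i) (cum c (i + 1))
  · obtain ⟨i, hi, h⟩ := h
    rw [flipMap_of_mem hc hi h]
    have h2 := reflect_mem_Ioo h
    have h3 := cum_mono hc (show i + 1 ≤ j from hi)
    exact ⟨(cum_nonneg hc i).trans h2.1.le, by linarith [h2.2]⟩
  · push Not at h
    rwa [flipMap_of_notMem h]

theorem continuousAt_flipMap (hc : ∀ i, 0 < c i) {y : ℝ}
    (h : ∀ i ≤ j, y ≠ cum c i) :
    ContinuousAt (flipMap c j) y := by
  by_cases h' : ∃ i < j, y ∈ Set.Ioo (cum c i) (cum c (i + 1))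
  · obtain ⟨i, hi, h'⟩ := h'
    have : ContinuousAt (fun y => cum c i + cum c (i + 1) - y) y := by fun_prop
    refine this.congr ?_
    filter_upwards [isOpen_Ioo.mem_nhds h'] with z hz
    exact (flipMap_of_mem hc hi hz).symm
  · push Not at h'
    -- Away from the closed intervals the map is the identity on a neighbourhood.
    have hopen : IsOpen (⋃ i ∈ Finset.range j, Set.Icc (cum c i) (cum c (i + 1)))ᶜ := by
      rw [isOpen_compl_iff]
      exact isClosed_biUnion_finset fun i _ => isClosed_Icc
    have hy : y ∈ (⋃ i ∈ Finset.range j, Set.Icc (cum c i) (cum c (i + 1)))ᶜ := by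
      simp only [Set.mem_compl_iff, Set.mem_iUnion, not_exists]
      intro i hi hyi
      exact h' i (Finset.mem_range.1 hi) ⟨lt_of_le_of_ne hyi.1 (h i (Finset.mem_range.1 hi).le).symm,
        lt_of_le_of_ne hyi.2 (h (i + 1) (Finset.mem_range.1 hi))⟩
    refine continuousAt_id.congr ?_
    filter_upwards [hopen.mem_nhds hy] with z hz
    refine (flipMap_of_notMem fun i hi hzi => hz ?_).symm
    exact Set.mem_biUnion (Finset.mem_coe.2 (Finset.mem_range.2 hi)) (Set.Ioo_subset_Icc_self hzi)

end FlipMap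

theorem bijOn_Icc_of_injective {n : ℕ} {q : Fin n → ℤ} (hinj : Function.Injective q)
    (hmem : ∀ α, q α ∈ Set.Icc (1 : ℤ) n) : Set.BijOn q Set.univ (Set.Icc 1 (n : ℤ)) := by
  refine ⟨fun α _ => hmem α, hinj.injOn, ?_⟩
  have h : Finset.univ.image q = Finset.Icc 1 (n : ℤ) := by
    refine Finset.eq_of_subset_of_card_le (fun y hy => ?_) ?_
    · obtain ⟨α, -, rfl⟩ := Finset.mem_image.1 hy
      exact Finset.mem_Icc.2 (hmem α)
    · rw [Finset.card_image_of_injective _ hinj]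
      simp
  intro y hy
  have hy' : y ∈ Finset.univ.image q := by
    rw [h]
    exact Finset.mem_Icc.2 hy
  obtain ⟨α, -, hα⟩ := Finset.mem_image.1 hy'
  exact ⟨α, trivial, hα⟩

/-- The sums of the lengths over initial segments of an ordering are the endpoints `G` of the
intervals. -/
theorem sum_le_eq {n : ℕ} {q : Fin n → ℤ} (hq : Set.BijOn q Set.univ (Set.Icc 1 (n : ℤ)))
    {len : Fin n → ℝ} {G : ℕ → ℝ} (h0 : G 0 = 0)
    (hG : ∀ α k, q α = (k + 1 : ℕ) → G (k + 1) = G k + len α) (k : ℕ) (hk : k ≤ n) :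
    ∑ β with q β ≤ (k : ℤ), len β = G k := by
  induction k with
  | zero =>
    rw [h0]
    refine Finset.sum_eq_zero fun β hβ => ?_
    have h1 := (Finset.mem_filter.1 hβ).2
    have h2 := (hq.mapsTo (Set.mem_univ β)).1
    push_cast at h1
    omega
  | succ k ih =>
    obtain ⟨α, -, hα⟩ := hq.surjOn (show ((k + 1 : ℕ) : ℤ) ∈ Set.Icc 1 (n : ℤ) by
      constructor <;> push_cast <;> omega)
    have hset : Finset.univ.filter (fun β => q β ≤ ((k + 1 : ℕ) : ℤ)) =
        insert α (Finset.univ.filter fun β => q β ≤ (k : ℤ)) := by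
      ext β
      simp only [Finset.mem_filter, Finset.mem_univ, true_and, Finset.mem_insert]
      constructor
      · intro h
        by_cases hβ : q β = q α
        · exact Or.inl (hq.injOn trivial trivial hβ)
        · right
          push_cast at h hα
          omega
      · rintro (rfl | h)
        · exact hα.le
        · push_cast
          omega
    rw [hset, Finset.sum_insert, ih (by omega), hG α k hα, add_comm]
    simp only [Finset.mem_filter, Finset.mem_univ, true_and, hα]
    push_cast
    omega

theorem sum_lt_eq {n : ℕ} {q : Fin n → ℤ} (hq : Set.BijOn q Set.univ (Set.Icc 1 (n : ℤ)))
    {len : Fin n → ℝ} {G : ℕ → ℝ} (h0 : G 0 = 0)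
    (hG : ∀ α k, q α = (k + 1 : ℕ) → G (k + 1) = G k + len α) {α : Fin n} {k : ℕ}
    (hα : q α = (k + 1 : ℕ)) : ∑ β with q β < q α, len β = G k := by
  have hk : q α ≤ n := (hq.mapsTo (Set.mem_univ α)).2
  rw [← sum_le_eq hq h0 hG k (by push_cast at hα; omega)]
  congr 1
  ext β
  simp only [Finset.mem_filter, Finset.mem_univ, true_and, hα]
  push_cast
  omega

theorem exists_mem_of_endpoints {G : ℕ → ℝ} {n : ℕ} {x : ℝ} (h0 : G 0 ≤ x) (hn : x < G n) :
    ∃ k < n, G k ≤ x ∧ x < G (k + 1) := by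
  classical
  have hex : ∃ k, x < G k := ⟨n, hn⟩
  obtain ⟨m, hm⟩ : ∃ m, Nat.find hex = m + 1 := by
    refine Nat.exists_eq_succ_of_ne_zero fun h => ?_
    have := Nat.find_spec hex
    rw [h] at this
    linarith
  refine ⟨m, ?_, ?_, ?_⟩
  · have := Nat.find_min' hex hn
    omega
  · exact not_lt.1 (Nat.find_min hex (by omega))
  · have := Nat.find_spec hex
    rwa [hm] at this

end FlipIET

/-! ### The exchange with flips: positions, endpoints and lengths -/

namespace FlipIET

open Exchange MeasureTheory

section FlipParam

/-- The position of the `k`-th interval after the exchange. -/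
def botPos (j e k : ℕ) : ℕ :=
  if k < j then j + 4 + k else if k < j + e then 2 * j + 4 else if k = j + e then j + 3
  else if k = j + e + 1 then j + 2 else if k < 2 * j + e + 2 then k - (j + e + 2) + 1 else j + 1

/-- The length of the `k`-th interval. -/
noncomputable def pieceLen (j e : ℕ) (x : Fin 4 → ℝ) (c : ℕ → ℝ) (k : ℕ) : ℝ :=
  if k < j then c k else if k < j + e then x 0 - cum c j else if k = j + e then x 1
  else if k = j + e + 1 then x 2 else if k < 2 * j + e + 2 then c (k - (j + e + 2))
  else x 3 - cum c j

def IsFlipped (j e k : ℕ) : Prop := k < j ∨ j + e + 2 ≤ k ∧ k < 2 * j + e + 2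

instance (j e k : ℕ) : Decidable (IsFlipped j e k) := by unfold IsFlipped; infer_instance

/-- The interval exchange with flips obtained by conjugating the reversal of four intervals of
lengths `x` by the map that reverses the intervals of lengths `c 0, …, c (j - 1)`. The first of the
four intervals is cut into the `j` reversed ones and, if `e = 1`, a remainder. -/
noncomputable def flipParam (j e : ℕ) (x : Fin 4 → ℝ) (c : ℕ → ℝ) : Param (2 * j + 3 + e) :=
  (fun α => pieceLen j e x c α, fun α => (α : ℕ) + 1,
    fun α => if IsFlipped j e α then -(botPos j e α : ℤ) else botPos j e α)

/-- The endpoints of the intervals before the exchange. -/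
noncomputable def topEnd (j e : ℕ) (x : Fin 4 → ℝ) (c : ℕ → ℝ) (k : ℕ) : ℝ :=
  if k ≤ j then cum c k else if k ≤ j + e then x 0 else if k = j + e + 1 then x 0 + x 1
  else if k = j + e + 2 then x 0 + x 1 + x 2
  else if k ≤ 2 * j + e + 2 then x 0 + x 1 + x 2 + cum c (k - (j + e + 2))
  else x 0 + x 1 + x 2 + x 3

/-- The endpoints of the intervals after the exchange. -/
noncomputable def botEnd (j : ℕ) (x : Fin 4 → ℝ) (c : ℕ → ℝ) (k : ℕ) : ℝ :=
  if k ≤ j then cum c k else if k = j + 1 then x 3 else if k = j + 2 then x 3 + x 2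
  else if k ≤ 2 * j + 3 then x 3 + x 2 + x 1 + cum c (k - (j + 3))
  else x 3 + x 2 + x 1 + x 0

variable {j e : ℕ} {x : Fin 4 → ℝ} {c : ℕ → ℝ}

/-- A case distinction according to the original interval and the part of it. -/
theorem piece_cases (he : e ≤ 1) {k : ℕ} (hk : k < 2 * j + 3 + e) :
    (k < j) ∨ (e = 1 ∧ k = j) ∨ k = j + e ∨ k = j + e + 1 ∨ (∃ i < j, k = j + e + 2 + i) ∨
      k = 2 * j + e + 2 := by
  by_cases h : j + e + 2 ≤ k
  · obtain ⟨i, rfl⟩ := Nat.exists_eq_add_of_le h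
    by_cases hi : i < j
    · exact Or.inr (Or.inr (Or.inr (Or.inr (Or.inl ⟨i, hi, rfl⟩))))
    · omega
  · omega

/-- The position of the `k`-th interval after the exchange, its endpoints before and after the
exchange, and its length. -/
structure PieceData (j e : ℕ) (x : Fin 4 → ℝ) (c : ℕ → ℝ) (k b : ℕ) (l l' r r' s : ℝ) : Prop where
  pos : botPos j e k = b + 1
  top_left : topEnd j e x c k = l
  top_right : topEnd j e x c (k + 1) = l'
  bot_left : botEnd j x c b = r
  bot_right : botEnd j x c (b + 1) = r'
  len : pieceLen j e x c k = s

theorem pieceData_flipped {i : ℕ} (hi : i < j) :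
    PieceData j e x c i (j + 3 + i) (cum c i) (cum c (i + 1)) (x 3 + x 2 + x 1 + cum c i)
      (x 3 + x 2 + x 1 + cum c (i + 1)) (c i) := by
  constructor
  · rw [botPos, if_pos hi]; ring
  · rw [topEnd, if_pos hi.le]
  · rw [topEnd, if_pos (Nat.succ_le_of_lt hi)]
  · unfold botEnd
    split_ifs <;> first | omega | skip
    congr 2; omega
  · unfold botEnd
    split_ifs <;> first | omega | skip
    congr 2; omega
  · rw [pieceLen, if_pos hi]

theorem pieceData_rest (he : e = 1) :
    PieceData j e x c j (2 * j + 3) (cum c j) (x 0) (x 3 + x 2 + x 1 + cum c j)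
      (x 3 + x 2 + x 1 + x 0) (x 0 - cum c j) := by
  subst he
  constructor
  · simp [botPos]
  · simp [topEnd]
  · simp [topEnd]
  · unfold botEnd
    split_ifs <;> first | omega | skip
    congr 2; omega
  · unfold botEnd
    split_ifs <;> first | omega | rfl
  · simp [pieceLen]

/-- For e = 0 there is no remainder, and `topEnd` records the left endpoint as `cum c j`; this is
where the flipped intervals must fill the first interval exactly. -/
theorem pieceData_one (he : e ≤ 1) (h0 : e = 0 → cum c j = x 0) :
    PieceData j e x c (j + e) (j + 2) (x 0) (x 0 + x 1) (x 3 + x 2) (x 3 + x 2 + x 1) (x 1) := by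
  constructor
  · unfold botPos
    split_ifs <;> omega
  · unfold topEnd
    split_ifs <;> first | omega | skip
    · have : e = 0 := by omega
      subst this
      exact h0 rfl
    · rfl
  · unfold topEnd
    split_ifs <;> first | omega | rfl
  · unfold botEnd
    split_ifs <;> first | omega | rfl
  · unfold botEnd
    split_ifs <;> first | omega | skip
    · rw [show j + 2 + 1 - (j + 3) = 0 by omega, cum_zero, add_zero]
  · unfold pieceLen
    split_ifs <;> first | omega | rfl

theorem pieceData_two :
    PieceData j e x c (j + e + 1) (j + 1) (x 0 + x 1) (x 0 + x 1 + x 2) (x 3) (x 3 + x 2)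
      (x 2) := by
  constructor
  · unfold botPos
    split_ifs <;> omega
  · unfold topEnd
    split_ifs <;> first | omega | rfl
  · unfold topEnd
    split_ifs <;> first | omega | rfl
  · unfold botEnd
    split_ifs <;> first | omega | rfl
  · unfold botEnd
    split_ifs <;> first | omega | rfl
  · unfold pieceLen
    split_ifs <;> first | omega | rfl

theorem pieceData_preimage {i : ℕ} (hi : i < j) :
    PieceData j e x c (j + e + 2 + i) i (x 0 + x 1 + x 2 + cum c i)
      (x 0 + x 1 + x 2 + cum c (i + 1)) (cum c i) (cum c (i + 1)) (c i) := by
  constructor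
  · unfold botPos
    split_ifs <;> omega
  · unfold topEnd
    split_ifs <;> first | omega | skip
    · have : i = 0 := by omega
      rw [this, cum_zero, add_zero]
    · congr 2; omega
  · unfold topEnd
    split_ifs <;> first | omega | skip
    congr 2; omega
  · rw [botEnd, if_pos hi.le]
  · rw [botEnd, if_pos (Nat.succ_le_of_lt hi)]
  · unfold pieceLen
    split_ifs <;> first | omega | skip
    congr 1; omega

theorem pieceData_three (hj : 0 < j) :
    PieceData j e x c (2 * j + e + 2) j (x 0 + x 1 + x 2 + cum c j) (x 0 + x 1 + x 2 + x 3)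
      (cum c j) (x 3) (x 3 - cum c j) := by
  constructor
  · unfold botPos
    split_ifs <;> omega
  · unfold topEnd
    split_ifs <;> first | omega | skip
    congr 2; omega
  · unfold topEnd
    split_ifs <;> first | omega | rfl
  · rw [botEnd, if_pos le_rfl]
  · unfold botEnd
    split_ifs <;> first | omega | rfl
  · unfold pieceLen
    split_ifs <;> first | omega | rfl

/-- The conditions under which the lengths fit together. -/
structure FlipFit (j e : ℕ) (x : Fin 4 → ℝ) (c : ℕ → ℝ) : Prop where
  j_pos : 0 < j
  e_le : e ≤ 1
  x_pos : ∀ i, 0 < x i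
  sum_eq : x 0 + x 1 + x 2 + x 3 = 1
  lt : x 0 < x 3
  c_pos : ∀ i, 0 < c i
  cum_eq : e = 0 → cum c j = x 0
  cum_lt : e = 1 → cum c j < x 0

namespace FlipFit

theorem cum_le (h : FlipFit j e x c) : cum c j ≤ x 0 := by
  have := h.e_le
  rcases Nat.lt_or_ge e 1 with he | he
  · exact (h.cum_eq (by omega)).le
  · exact (h.cum_lt (by omega)).le

theorem exists_pieceData (h : FlipFit j e x c) {k : ℕ} (hk : k < 2 * j + 3 + e) :
    ∃ b l l' r r' s, PieceData j e x c k b l l' r r' s ∧ 0 < s ∧ l' = l + s ∧ r' = r + s := by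
  rcases piece_cases h.e_le hk with hi | ⟨he, rfl⟩ | rfl | rfl | ⟨i, hi, rfl⟩ | rfl
  · exact ⟨_, _, _, _, _, _, pieceData_flipped hi, h.c_pos _, cum_succ _ _, by
      rw [cum_succ]; ring⟩
  · exact ⟨_, _, _, _, _, _, pieceData_rest he, by linarith [h.cum_lt he], by ring, by ring⟩
  · exact ⟨_, _, _, _, _, _, pieceData_one h.e_le h.cum_eq, h.x_pos _, rfl, rfl⟩
  · exact ⟨_, _, _, _, _, _, pieceData_two, h.x_pos _, rfl, rfl⟩
  · exact ⟨_, _, _, _, _, _, pieceData_preimage hi, h.c_pos _, by rw [cum_succ]; ring,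
      cum_succ _ _⟩
  · exact ⟨_, _, _, _, _, _, pieceData_three h.j_pos, by linarith [h.cum_le, h.lt], by ring,
      by ring⟩

theorem bijOn_top (j e : ℕ) (x : Fin 4 → ℝ) (c : ℕ → ℝ) :
    Set.BijOn (flipParam j e x c).2.1 Set.univ (Set.Icc 1 ((2 * j + 3 + e : ℕ) : ℤ)) := by
  refine bijOn_Icc_of_injective (fun α β h => ?_) fun α => ?_
  · simp only [flipParam] at h
    exact Fin.ext (by omega)
  · have := α.isLt
    constructor <;> simp only [flipParam] <;> omega

theorem abs_bot (j e : ℕ) (x : Fin 4 → ℝ) (c : ℕ → ℝ) (α : Fin (2 * j + 3 + e)) :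
    |(flipParam j e x c).2.2 α| = botPos j e α := by
  simp only [flipParam]
  split_ifs <;> simp

theorem botPos_injective (he : e ≤ 1) {k k' : ℕ} (hk : k < 2 * j + 3 + e)
    (hk' : k' < 2 * j + 3 + e) (h : botPos j e k = botPos j e k') : k = k' := by
  unfold botPos at h
  split_ifs at h <;> omega

theorem bijOn_bot (he : e ≤ 1) (x : Fin 4 → ℝ) (c : ℕ → ℝ) :
    Set.BijOn (fun α => |(flipParam j e x c).2.2 α|) Set.univ
      (Set.Icc 1 ((2 * j + 3 + e : ℕ) : ℤ)) := by
  refine bijOn_Icc_of_injective (fun α β h => ?_) fun α => ?_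
  · simp only [abs_bot] at h
    exact Fin.ext (botPos_injective he α.isLt β.isLt (by exact_mod_cast h))
  · have := α.isLt
    simp only [abs_bot, botPos]
    constructor <;> split_ifs <;> push_cast <;> omega

theorem topEnd_zero (j e : ℕ) (x : Fin 4 → ℝ) (c : ℕ → ℝ) : topEnd j e x c 0 = 0 := by
  rw [topEnd, if_pos (Nat.zero_le j), cum_zero]

theorem botEnd_zero (j : ℕ) (x : Fin 4 → ℝ) (c : ℕ → ℝ) : botEnd j x c 0 = 0 := by
  rw [botEnd, if_pos (Nat.zero_le j), cum_zero]

theorem topEnd_last (h : FlipFit j e x c) : topEnd j e x c (2 * j + 3 + e) = 1 := by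
  have := (pieceData_three (x := x) (c := c) (e := e) h.j_pos).top_right
  rw [h.sum_eq] at this
  rw [← this]
  congr 1
  ring

theorem topEnd_step (h : FlipFit j e x c) (α : Fin (2 * j + 3 + e)) (k : ℕ)
    (hα : (flipParam j e x c).2.1 α = (k + 1 : ℕ)) :
    topEnd j e x c (k + 1) = topEnd j e x c k + (flipParam j e x c).1 α := by
  have hk : k = α := by
    simp only [flipParam] at hα
    omega
  subst hk
  obtain ⟨b, l, l', r, r', s, hd, -, h1, -⟩ := h.exists_pieceData α.isLt
  rw [hd.top_left, hd.top_right, h1]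
  congr 1
  exact hd.len.symm

theorem botEnd_step (h : FlipFit j e x c) (α : Fin (2 * j + 3 + e)) (k : ℕ)
    (hα : |(flipParam j e x c).2.2 α| = (k + 1 : ℕ)) :
    botEnd j x c (k + 1) = botEnd j x c k + (flipParam j e x c).1 α := by
  obtain ⟨b, l, l', r, r', s, hd, -, -, h1⟩ := h.exists_pieceData α.isLt
  have hk : k = b := by
    rw [abs_bot, hd.pos] at hα
    omega
  subst hk
  rw [hd.bot_left, hd.bot_right, h1]
  congr 1
  exact hd.len.symm

theorem leftEnd_eq (h : FlipFit j e x c) (α : Fin (2 * j + 3 + e)) :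
    leftEnd (flipParam j e x c) α = topEnd j e x c α :=
  sum_lt_eq (bijOn_top j e x c) (topEnd_zero j e x c) h.topEnd_step
    (by simp only [flipParam]; push_cast; rfl)

theorem imageLeftEnd_eq (h : FlipFit j e x c) {α : Fin (2 * j + 3 + e)} {b : ℕ}
    (hb : botPos j e α = b + 1) : imageLeftEnd (flipParam j e x c) α = botEnd j x c b :=
  sum_lt_eq (bijOn_bot h.e_le x c) (botEnd_zero j x c) h.botEnd_step (by rw [abs_bot, hb])

theorem imageRightEnd_eq (h : FlipFit j e x c) {α : Fin (2 * j + 3 + e)} {b : ℕ}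
    (hb : botPos j e α = b + 1) : imageRightEnd (flipParam j e x c) α = botEnd j x c (b + 1) := by
  have h1 := (bijOn_bot (j := j) h.e_le x c).mapsTo (Set.mem_univ α)
  simp only [abs_bot, hb, Set.mem_Icc] at h1
  rw [← sum_le_eq (bijOn_bot h.e_le x c) (botEnd_zero j x c) h.botEnd_step (b + 1)
    (by exact_mod_cast h1.2), imageRightEnd, abs_bot, hb]

theorem isFIET (h : FlipFit j e x c) : IsFIET (flipParam j e x c) := by
  refine ⟨fun α => ?_, ?_, ⟨bijOn_top j e x c, bijOn_bot h.e_le x c⟩, ?_⟩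
  · obtain ⟨b, l, l', r, r', s, hd, hs, -⟩ := h.exists_pieceData α.isLt
    change 0 < pieceLen j e x c α
    rwa [hd.len]
  · rw [← h.topEnd_last, ← sum_le_eq (bijOn_top j e x c) (topEnd_zero j e x c) h.topEnd_step _ le_rfl]
    refine (Finset.sum_congr (Finset.filter_true_of_mem fun α _ => ?_) fun _ _ => rfl).symm
    exact ((bijOn_top j e x c).mapsTo (Set.mem_univ α)).2
  · refine ⟨⟨0, by omega⟩, ?_⟩
    have h1 : IsFlipped j e 0 := Or.inl h.j_pos
    have h2 : 0 < botPos j e 0 := by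
      rw [botPos, if_pos h.j_pos]
      omega
    simp only [flipSet, flipParam, Set.mem_ofPred_eq, h1, if_true]
    omega

/-- The endpoints of an interval of the transformation, and the values on it. -/
theorem step_iff (h : FlipFit j e x c) {α : Fin (2 * j + 3 + e)} {b : ℕ} {l l' r r' s : ℝ}
    (hd : PieceData j e x c α b l l' r r' s) (hl : l' = l + s) (y z : ℝ) :
    (y ∈ openPiece (flipParam j e x c) α ∧
      ((α ∉ flipSet (flipParam j e x c).2.2 ∧
        z = y + (imageLeftEnd (flipParam j e x c) α - leftEnd (flipParam j e x c) α)) ∨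
      (α ∈ flipSet (flipParam j e x c).2.2 ∧
        z = (imageRightEnd (flipParam j e x c) α + leftEnd (flipParam j e x c) α) - y))) ↔
    y ∈ Set.Ioo l l' ∧ ((¬ IsFlipped j e α ∧ z = y + (r - l)) ∨
      (IsFlipped j e α ∧ z = r' + l - y)) := by
  have hf : α ∈ flipSet (flipParam j e x c).2.2 ↔ IsFlipped j e α := by
    have := hd.pos
    simp only [flipSet, flipParam, Set.mem_ofPred_eq]
    split_ifs with hα <;> simp only [hα, iff_true, iff_false] <;> omega
  have hlen : (flipParam j e x c).1 α = s := hd.len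
  rw [hf, h.imageLeftEnd_eq hd.pos, h.imageRightEnd_eq hd.pos, openPiece, h.leftEnd_eq, hlen,
    hd.bot_left, hd.bot_right, hd.top_left, hl]

end FlipFit

end FlipParam

end FlipIET

/-! ### The exchange with flips is conjugate to the reversal -/

namespace FlipIET

open Exchange MeasureTheory

section Reversal

variable {x : Fin 4 → ℝ}

theorem reversal_map_zero (hx : ∀ i, 0 < x i) (hs : x 0 + x 1 + x 2 + x 3 = 1) {y : ℝ}
    (hy : y ∈ Set.Ico 0 (x 0)) : (reversal x).map y = y + (x 3 + x 2 + x 1) := by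
  rw [(reversal_valid hx).map_eq (i := 0) (by simpa [piece, ofRanks, Fin.sum_univ_four, hs] using hy)]
  simp [shift, ofRanks, Fin.sum_univ_four]
  ring

theorem reversal_piece_one (hs : x 0 + x 1 + x 2 + x 3 = 1) :
    (reversal x).piece 1 = Set.Ico (x 0) (x 0 + x 1) := by
  simp [piece, ofRanks, Fin.sum_univ_four, hs]

theorem reversal_map_one (hx : ∀ i, 0 < x i) (hs : x 0 + x 1 + x 2 + x 3 = 1) {y : ℝ}
    (hy : y ∈ Set.Ico (x 0) (x 0 + x 1)) : (reversal x).map y = y + (x 3 + x 2 - x 0) := by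
  rw [(reversal_valid hx).map_eq (i := 1) (by rwa [reversal_piece_one hs])]
  simp [shift, ofRanks, Fin.sum_univ_four]
  ring

theorem reversal_map_two (hx : ∀ i, 0 < x i) (hs : x 0 + x 1 + x 2 + x 3 = 1) {y : ℝ}
    (hy : y ∈ Set.Ico (x 0 + x 1) (x 0 + x 1 + x 2)) :
    (reversal x).map y = y + (x 3 - (x 0 + x 1)) := by
  rw [(reversal_valid hx).map_eq (i := 2) (by simpa [piece, ofRanks, Fin.sum_univ_four, hs] using hy)]
  simp [shift, ofRanks, Fin.sum_univ_four]

theorem reversal_map_three (hx : ∀ i, 0 < x i) (hs : x 0 + x 1 + x 2 + x 3 = 1) {y : ℝ}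
    (hy : y ∈ Set.Ico (x 0 + x 1 + x 2) 1) :
    (reversal x).map y = y - (x 0 + x 1 + x 2) := by
  rw [(reversal_valid hx).map_eq (i := 3) (by simpa [piece, ofRanks, Fin.sum_univ_four, hs] using hy)]
  simp [shift, ofRanks, Fin.sum_univ_four]
  ring

end Reversal

namespace FlipFit

variable {j e : ℕ} {x : Fin 4 → ℝ} {c : ℕ → ℝ}

/-- The reversed intervals fill [0, cum c j), and cum c j ≤ x 0 < x 3. Only the last of the four
intervals has an image reaching into this region, so g acts nontrivially either before T (on the
reversed intervals) or after T (on their preimages), never both. -/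
theorem step_conj (h : FlipFit j e x c) {y z : ℝ} (hyz : Step (flipParam j e x c) y z) :
    y ∈ Set.Ico (0 : ℝ) 1 ∧ flipMap c j z = (reversal x).map (flipMap c j y) := by
  obtain ⟨⟨k, hk⟩, hα⟩ := hyz
  have x0 := h.x_pos 0
  have x1 := h.x_pos 1
  have x2 := h.x_pos 2
  have x3 := h.x_pos 3
  have hs := h.sum_eq
  have hle := h.cum_le
  have hlt := h.lt
  have h0 := cum_nonneg h.c_pos j
  rcases piece_cases h.e_le hk with hi | ⟨he, rfl⟩ | rfl | rfl | ⟨i, hi, rfl⟩ | rfl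
  · rw [h.step_iff (pieceData_flipped hi) (cum_succ c k)] at hα
    have hf : IsFlipped j e k := Or.inl hi
    obtain ⟨hy, ⟨hn, -⟩ | ⟨-, rfl⟩⟩ := hα
    · exact absurd hf hn
    have h1 := cum_nonneg h.c_pos k
    have h2 := cum_mono h.c_pos (show k + 1 ≤ j from hi)
    have h3 := reflect_mem_Ioo hy
    refine ⟨⟨h1.trans hy.1.le, by linarith [hy.2]⟩, ?_⟩
    rw [flipMap_of_mem h.c_pos hi hy, flipMap_of_ge h.c_pos (by linarith [hy.2]),
      reversal_map_zero h.x_pos hs ⟨by linarith [h3.1], by linarith [h3.2]⟩]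
    ring
  · rw [h.step_iff (pieceData_rest he) (by ring)] at hα
    have hf : ¬ IsFlipped k e k := by unfold IsFlipped; omega
    obtain ⟨hy, ⟨-, rfl⟩ | ⟨hn, -⟩⟩ := hα
    swap
    · exact absurd hn hf
    refine ⟨⟨by linarith [hy.1], by linarith [hy.2]⟩, ?_⟩
    rw [flipMap_of_ge h.c_pos hy.1.le, flipMap_of_ge h.c_pos (by linarith [hy.1]),
      reversal_map_zero h.x_pos hs ⟨by linarith [hy.1], hy.2⟩]
    ring
  · rw [h.step_iff (pieceData_one h.e_le h.cum_eq) rfl] at hα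
    have hf : ¬ IsFlipped j e (j + e) := by unfold IsFlipped; omega
    obtain ⟨hy, ⟨-, rfl⟩ | ⟨hn, -⟩⟩ := hα
    swap
    · exact absurd hn hf
    refine ⟨⟨by linarith [hy.1], by linarith [hy.2]⟩, ?_⟩
    rw [flipMap_of_ge h.c_pos (hle.trans hy.1.le), flipMap_of_ge h.c_pos (by linarith [hy.1]),
      reversal_map_one h.x_pos hs ⟨hy.1.le, hy.2⟩]
  · rw [h.step_iff pieceData_two rfl] at hα
    have hf : ¬ IsFlipped j e (j + e + 1) := by unfold IsFlipped; omega
    obtain ⟨hy, ⟨-, rfl⟩ | ⟨hn, -⟩⟩ := hα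
    swap
    · exact absurd hn hf
    refine ⟨⟨by linarith [hy.1], by linarith [hy.2]⟩, ?_⟩
    rw [flipMap_of_ge h.c_pos (by linarith [hy.1]), flipMap_of_ge h.c_pos (by linarith [hy.1]),
      reversal_map_two h.x_pos hs ⟨hy.1.le, hy.2⟩]
  · rw [h.step_iff (pieceData_preimage hi) (by rw [cum_succ]; ring)] at hα
    have hf : IsFlipped j e (j + e + 2 + i) := Or.inr ⟨by omega, by omega⟩
    obtain ⟨hy, ⟨hn, -⟩ | ⟨-, rfl⟩⟩ := hα
    · exact absurd hf hn
    have h1 := cum_nonneg h.c_pos i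
    have h2 := cum_mono h.c_pos (show i + 1 ≤ j from hi)
    refine ⟨⟨by linarith [hy.1], by linarith [hy.2]⟩, ?_⟩
    rw [flipMap_of_ge h.c_pos (y := y) (by linarith [hy.1]),
      flipMap_of_mem h.c_pos hi ⟨by linarith [hy.2], by linarith [hy.1]⟩,
      reversal_map_three h.x_pos hs ⟨by linarith [hy.1], by linarith [hy.2]⟩]
    ring
  · rw [h.step_iff (pieceData_three h.j_pos) (by ring)] at hα
    have hf : ¬ IsFlipped j e (2 * j + e + 2) := by unfold IsFlipped; omega
    obtain ⟨hy, ⟨-, rfl⟩ | ⟨hn, -⟩⟩ := hα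
    swap
    · exact absurd hn hf
    refine ⟨⟨by linarith [hy.1], by linarith [hy.2]⟩, ?_⟩
    rw [flipMap_of_ge h.c_pos (y := y) (by linarith [hy.1]),
      flipMap_of_ge h.c_pos (by linarith [hy.1]),
      reversal_map_three h.x_pos hs ⟨by linarith [hy.1], by linarith [hy.2]⟩]
    ring

theorem exists_step (h : FlipFit j e x c) {y : ℝ} (hy : y ∈ Set.Ico (0 : ℝ) 1)
    (hne : ∀ k, y ≠ topEnd j e x c k) : ∃ z, Step (flipParam j e x c) y z := by
  obtain ⟨k, hk, h1, h2⟩ := exists_mem_of_endpoints (G := topEnd j e x c) (x := y)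
    (by rw [topEnd_zero]; exact hy.1) (by rw [h.topEnd_last]; exact hy.2)
  obtain ⟨b, l, l', r, r', s, hd, -, hl, -⟩ := h.exists_pieceData hk
  rw [hd.top_left] at h1
  rw [hd.top_right] at h2
  have h3 : l < y := lt_of_le_of_ne h1 (by rw [← hd.top_left]; exact (hne k).symm)
  by_cases hf : IsFlipped j e k
  · exact ⟨_, ⟨k, hk⟩, (h.step_iff hd hl y _).2 ⟨⟨h3, h2⟩, Or.inr ⟨hf, rfl⟩⟩⟩
  · exact ⟨_, ⟨k, hk⟩, (h.step_iff hd hl y _).2 ⟨⟨h3, h2⟩, Or.inl ⟨hf, rfl⟩⟩⟩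

end FlipFit

theorem topEnd_const {j e : ℕ} {x : Fin 4 → ℝ} {c : ℕ → ℝ} {k : ℕ} (hk : 2 * j + e + 3 ≤ k) :
    topEnd j e x c k = x 0 + x 1 + x 2 + x 3 := by
  unfold topEnd
  split_ifs <;> first | omega | rfl

/-- The sequences `L` and `L'` give two invariant measures of the reversal with different masses of
the piece 1, and this piece is not touched by the reversing map. -/
theorem flipParam_mem_NUE {j e : ℕ} {c : ℕ → ℝ} {L L' : ℕ → Fin 4 → ℝ} (hL : Admissible L)
    (hL' : Admissible L') (hne : L' 0 1 ≠ L 0 1) (h : FlipFit j e (L 0) c) :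
    flipParam j e (L 0) c ∈ NUE (2 * j + 3 + e) := by
  set p := flipParam j e (L 0) c
  set g := flipMap c j
  set T := (reversal (L 0)).map
  -- All endpoints of pieces. The exceptional set is `W ∪ g '' W` because it has to be stable under
  -- g.
  set W : Set ℝ := topEnd j e (L 0) c '' Set.Iic (2 * j + e + 3)
  have hgg : Function.Involutive g := involutive_flipMap h.c_pos
  have hgm : Measurable g := measurable_flipMap c j
  have hle1 : cum c j ≤ 1 := by
    linarith [h.cum_le, h.sum_eq, h.x_pos 1, h.x_pos 2, h.x_pos 3]
  have hgI : ∀ x ∈ Set.Ico (0 : ℝ) 1, g x ∈ Set.Ico (0 : ℝ) 1 := fun x hx =>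
    flipMap_mem_Ico h.c_pos hle1 hx
  have hW : W.Finite := (Set.finite_Iic _).image _
  have hZ : (W ∪ g '' W).Finite := hW.union (hW.image g)
  have hWmem : ∀ k, topEnd j e (L 0) c k ∈ W := by
    intro k
    rcases le_or_gt k (2 * j + e + 3) with hk | hk
    · exact ⟨k, hk, rfl⟩
    · exact ⟨2 * j + e + 3, Set.self_mem_Iic, by rw [topEnd_const le_rfl, topEnd_const hk.le]⟩
  have hgZ : ∀ x, x ∉ W ∪ g '' W → g x ∉ W ∪ g '' W := by
    rintro x hx (hg | ⟨w, hw, he⟩)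
    · exact hx (Or.inr ⟨g x, hg, hgg x⟩)
    · exact hx (Or.inl (hgg.injective he ▸ hw))
  have hstep : ∀ y z, Step p y z → y ∈ Set.Ico (0 : ℝ) 1 ∧ g z = T (g y) := fun _ _ => h.step_conj
  have hcover : ∀ y ∈ Set.Ico (0 : ℝ) 1, y ∉ W ∪ g '' W → ∃ z, Step p y z := fun y hy hyW =>
    h.exists_step hy fun k hk => hyW (Or.inl (hk ▸ hWmem k))
  have hcont : ∀ y, y ∉ W ∪ g '' W → ContinuousAt g y := by
    refine fun y hyW => continuousAt_flipMap h.c_pos fun i hi hyi => hyW (Or.inl ?_)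
    -- The endpoints of the reversed intervals are the first values of `topEnd`.
    rw [hyi, ← if_pos (c := i ≤ j) (t := cum c i) (e := _) hi]
    exact hWmem i
  refine ⟨h.isFIET, isMinimal_of_conj hstep hgg hgI hZ hgZ hcont
    fun z hz ε hε => hL.exists_iterate hε hz, ?_⟩
  rintro ⟨μ, -, huniq⟩
  have hinv : ∀ {L'}, Admissible L' → ∃ ν : Measure ℝ, IsInvariantProb p ν ∧
      ν ((reversal (L 0)).piece 1) = ENNReal.ofReal (L' 0 1) := by
    intro L' hL'
    obtain ⟨ν, h1, h2, h3, h4, h5⟩ := hL.exists_invariant hL'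
    refine ⟨ν.map g, isInvariantProb_of_conj hstep hgg hgm (hL.valid 0).measurable_map hgI hZ
      hcover h1 h2 h3 h4, ?_⟩
    rw [Measure.map_apply hgm (measurableSet_piece _ _), ← h5 1]
    congr 1
    ext y
    have hfix : ∀ y, y ∈ (reversal (L 0)).piece 1 → g y = y := by
      intro y hy
      rw [reversal_piece_one h.sum_eq] at hy
      exact flipMap_of_ge h.c_pos (h.cum_le.trans hy.1)
    constructor
    · intro hy
      have := hfix _ hy
      rw [hgg y] at this
      rw [this]
      exact hy
    · intro hy
      rw [Set.mem_preimage, hfix y hy]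
      exact hy
  obtain ⟨ν₁, h1, h1'⟩ := hinv hL
  obtain ⟨ν₂, h2, h2'⟩ := hinv hL'
  rw [huniq _ h1, ← huniq _ h2, h2'] at h1'
  exact hne ((ENNReal.ofReal_eq_ofReal_iff (hL'.pos 0 1).le (hL.pos 0 1).le).1 h1')

end FlipIET

/-! ### Free parameters and the Hausdorff dimension -/

namespace FlipIET

open Exchange

theorem Exchange.Admissible.zero_lt_three {L : ℕ → Fin 4 → ℝ} (h : Admissible L) :
    L 0 0 < L 0 3 := by
  obtain ⟨e0, -, -, e3⟩ := fullRound_apply 0 (L 1)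
  have e := h.round 0
  rw [zero_add] at e
  rw [← e] at e0 e3
  have h0 := h.pos 1 0
  have h1 := h.pos 1 1
  have h2 := h.pos 1 2
  have h3 := h.pos 1 3
  have : 0 ≤ (paramB 0 : ℝ) * (L 1 0 + L 1 1) := by positivity
  linarith

/-- The flipped intervals may have arbitrary small lengths, independently of the length of the
interval `1`. -/
theorem exists_mem_NUE (m : ℕ) {e : ℕ} (he : e ≤ 1) : ∃ δ > 0, ∀ (y : ℕ → ℝ) (s : ℝ),
    (∀ i < m, y i ∈ Set.Ioo 0 δ) → s ∈ Set.Ioo (1 / 7 : ℝ) (1 / 6) →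
    ∃ x c, flipParam (m + 1) e x c ∈ NUE (2 * (m + 1) + 3 + e) ∧ (∀ i < m, c i = y i) ∧ x 1 = s := by
  obtain ⟨δ, hδ, hfam⟩ := exists_admissible_family
  refine ⟨δ / (m + 1), by positivity, fun y s hy hs => ?_⟩
  obtain ⟨L, L', hL, hL', h1, h1', h0⟩ := hfam s hs
  -- The last reversed interval takes all the space left in the first interval if e = 0, and half of
  -- it if e = 1.
  set r := (L 0 0 - ∑ i ∈ Finset.range m, y i) / (1 + e)
  -- The value 1 beyond index m only serves to keep all `c i` positive.
  set c : ℕ → ℝ := fun i => if i < m then y i else if i = m then r else 1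
  have hsum : ∑ i ∈ Finset.range m, y i < L 0 0 := by
    have h2 : ∑ i ∈ Finset.range m, y i ≤ ∑ i ∈ Finset.range m, δ / (m + 1) :=
      Finset.sum_le_sum fun i hi => (hy i (Finset.mem_range.1 hi)).2.le
    rw [Finset.sum_const, Finset.card_range, nsmul_eq_mul] at h2
    have h3 : (m : ℝ) * (δ / (m + 1)) < δ := by
      rw [mul_div_assoc', div_lt_iff₀ (by positivity)]
      linarith
    linarith
  have hr : 0 < r := div_pos (by linarith) (by positivity)
  have hcum : cum c (m + 1) = ∑ i ∈ Finset.range m, y i + r := by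
    rw [cum_succ, cum]
    congr 1
    · exact Finset.sum_congr rfl fun i hi => if_pos (Finset.mem_range.1 hi)
    · simp [c]
  refine ⟨L 0, c, flipParam_mem_NUE hL hL' (by rwa [h1]) ⟨Nat.succ_pos m, he, hL.pos 0, ?_,
    hL.zero_lt_three, fun i => ?_, ?_, ?_⟩, fun i hi => if_pos hi, h1⟩
  · rw [← Fin.sum_univ_four]
    exact hL.sum_eq
  · simp only [c]
    split_ifs with h2
    · exact (hy i h2).1
    · exact hr
    · exact one_pos
  · rintro rfl
    rw [hcum]
    simp [r]
  · rintro rfl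
    rw [hcum]
    simp only [r, Nat.cast_one]
    linarith

/-- The j free coordinates are the first j - 1 lengths, of reversed intervals, and the length with
index j + e, which is that of the interval 1 of the reversal. -/
theorem le_dimH_NUE {j e : ℕ} (hj : 0 < j) (he : e ≤ 1) :
    (j : ℝ≥0∞) ≤ dimH (NUE (2 * j + 3 + e)) := by
  obtain ⟨m, rfl⟩ := Nat.exists_eq_succ_of_ne_zero hj.ne'
  obtain ⟨δ, hδ, hmem⟩ := exists_mem_NUE m he
  set σ : Fin (m + 1) → Fin (2 * (m + 1) + 3 + e) := fun i =>
    if (i : ℕ) < m then ⟨i, by omega⟩ else ⟨m + 1 + e, by omega⟩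
  set Φ : Param (2 * (m + 1) + 3 + e) → Fin (m + 1) → ℝ := fun p i => p.1 (σ i)
  have hΦ : LipschitzWith 1 Φ := by
    refine LipschitzWith.of_edist_le fun p q => ?_
    refine edist_pi_le_iff.2 fun i => ?_
    exact (edist_le_pi_edist p.1 q.1 (σ i)).trans (le_max_left _ _)
  set U : Set (Fin (m + 1) → ℝ) := Set.pi Set.univ fun i =>
    if (i : ℕ) < m then Set.Ioo 0 δ else Set.Ioo (1 / 7) (1 / 6)
  have hUopen : IsOpen U := by
    refine isOpen_set_pi Set.finite_univ fun i _ => ?_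
    split_ifs <;> exact isOpen_Ioo
  have hUne : U.Nonempty := by
    refine Set.univ_pi_nonempty_iff.2 fun i => ?_
    split_ifs
    · exact Set.nonempty_Ioo.2 hδ
    · exact Set.nonempty_Ioo.2 (by norm_num)
  have hsub : U ⊆ Φ '' NUE (2 * (m + 1) + 3 + e) := by
    intro y hy
    have hy1 : ∀ i < m, (if h : i < m + 1 then y ⟨i, h⟩ else 0) ∈ Set.Ioo 0 δ := by
      intro i hi
      have h1 := hy ⟨i, by omega⟩ trivial
      simp only [hi, if_true] at h1
      rwa [dif_pos (by omega)]
    have hy2 : y (Fin.last m) ∈ Set.Ioo (1 / 7 : ℝ) (1 / 6) := by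
      have h1 := hy (Fin.last m) trivial
      simpa using h1
    obtain ⟨x, c, hp, hc, hx⟩ := hmem _ _ hy1 hy2
    refine ⟨_, hp, ?_⟩
    ext i
    by_cases hi : (i : ℕ) < m
    · have h1 : σ i = ⟨i, by omega⟩ := if_pos hi
      change pieceLen (m + 1) e x c (σ i) = y i
      rw [h1, pieceLen, if_pos (by simp only; omega)]
      simp only [hc i hi, i.isLt, dif_pos]
    · have h1 : σ i = ⟨m + 1 + e, by omega⟩ := if_neg hi
      have h2 : Fin.last m = i := Fin.ext (by simp only [Fin.val_last]; omega)
      rw [h2] at hx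
      change pieceLen (m + 1) e x c (σ i) = y i
      rw [h1, ← hx, pieceLen, if_neg (by simp only; omega), if_neg (by simp only; omega),
        if_pos rfl]
  calc ((m + 1 : ℕ) : ℝ≥0∞) = dimH U := by
        rw [Real.dimH_of_nonempty_interior (by rwa [hUopen.interior_eq])]
        simp
    _ ≤ dimH (Φ '' NUE (2 * (m + 1) + 3 + e)) := dimH_mono hsub
    _ ≤ dimH (NUE (2 * (m + 1) + 3 + e)) := hΦ.dimH_image_le _

end FlipIET

theorem theorem2 (n : ℕ) (hn : 2 ≤ n) :
    (((n - 1) / 2 - 1 : ℕ) : ℝ≥0∞) ≤ dimH (FlipIET.NUE n) := by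
  rcases Nat.eq_zero_or_pos ((n - 1) / 2 - 1) with h | h
  · rw [h]
    simp
  -- The parity of n - 1 decides whether the first interval keeps an unreversed remainder.
  · obtain ⟨e, he, hne⟩ : ∃ e ≤ 1, n = 2 * ((n - 1) / 2 - 1) + 3 + e :=
      ⟨(n - 1) % 2, by omega, by omega⟩
    have := FlipIET.le_dimH_NUE h he
    rwa [← hne] at this
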